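/- Let $\mathcal H$ be a Hilbert space of finite dimension at least $2$, let $|\Psi\rangle\in\mathcal H$ be a unit vector, let $0<\lambda<1$, $\nu:=1-\lambda$, $\Omega:=|\Psi\rangle\langle\Psi|+\lambda(\mathbb 1-|\Psi\rangle\langle\Psi|)$ and $\overline\Omega:=\mathbb 1-\Omega$. For integers $k\ge 0$, $N\ge k+1$ and a permutation-invariant density operator $\rho$ on $\mathcal H^{\otimes(N+1)}$ put $$p_k(\rho)=\sum_{i=0}^k\binom Ni\operatorname{tr}\big([\Omega^{\otimes(N-i)}\otimes\overline\Omega^{\otimes i}\otimes\mathbb 1]\rho\big),\qquad f_k(\rho)=\sum_{i=0}^k\binom Ni\operatorname{tr}\big([\Omega^{\otimes(N-i)}\otimes\overline\Omega^{\otimes i}\otimes|\Psi\rangle\langle\Psi|]\rho\big),$$ and $F_k(\rho)=f_k(\rho)/p_k(\rho)$ when $p_k(\rho)>0$. For $0<\delta\le 1$ define the guaranteed infidelity $$\bar\epsilon_\lambda(k,N,\delta):=1-\min_\rho\{F_k(\rho)\mid p_k(\rho)\ge\delta\},$$ the minimum being over all permutation-invariant states $\rho$ on $\mathcal H^{\otimes(N+1)}$,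 and define $$N_k(\epsilon,\delta,\lambda):=\min\{N\ge k+1\mid \bar\epsilon_\lambda(k,N,\delta)\le\epsilon\}.$$ **Proposition.** Suppose $0<\lambda,\epsilon<1$, $0<\delta\le 1/2$ and $k\in\mathbb Z^{\ge 0}$. Then the minima above (the first one for every $N\ge k+1$) exist, and $$\frac{k}{\nu\epsilon}\le N_k(\epsilon,\delta,\lambda)<\frac{k}{\nu\epsilon}+\frac{\ln\delta^{-1}}{2\nu^2\lambda\epsilon}+\frac{\sqrt{2\nu k\ln\delta^{-1}}}{2\nu^2\lambda\epsilon}+\frac{\sqrt{\lambda k}}{\lambda\epsilon}+\frac{2}{\lambda\epsilon},$$ $$N_k(\epsilon,\delta,\lambda)\ge\frac{(1-\nu\epsilon)\ln\delta^{-1}}{\lambda\epsilon\ln\lambda^{-1}}-\frac{(1-\epsilon)(k+1)}{\lambda\epsilon}-2.$$ If in addition $1/2\le\lambda<1$, then $$N_k(\epsilon,\delta,\lambda)<\frac{k}{\nu\epsilon}+\frac{2\ln\delta^{-1}}{\nu\epsilon}+\frac{\sqrt{2\lambda k\ln\delta^{-1}}}{\lambda\nu\epsilon}+\frac{\sqrt{\lambda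 k}}{\lambda\epsilon}+\frac{2}{\lambda\epsilon}.$$ -/

import Mathlib

open scoped ComplexOrder

/-- The tensor product `A 0 ⊗ A 1 ⊗ ⋯ ⊗ A (n - 1)` of operators on `ℂ^ι`, as a matrix in the
product basis of `(ℂ^ι)^{⊗ n}`, which is indexed by the words `Fin n → ι`. -/
def tensorOp {ι : Type*} {n : ℕ} (A : Fin n → Matrix ι ι ℂ) :
    Matrix (Fin n → ι) (Fin n → ι) ℂ :=
  Matrix.of fun x y => ∏ j, A j (x j) (y j)

/-- The rank-one projector `|Ψ⟩⟨Ψ|` (for a unit vector `Ψ`). -/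
def pureProj {ι : Type*} (Ψ : EuclideanSpace ℂ ι) : Matrix ι ι ℂ :=
  Matrix.of fun a b => Ψ a * star (Ψ b)

/-- The homogeneous verification strategy `Ω = |Ψ⟩⟨Ψ| + lam (1 - |Ψ⟩⟨Ψ|)`. It is the pass operator of
one test; the failure operator is `1 - Ω`. -/
noncomputable def strategy {ι : Type*} [DecidableEq ι] (Ψ : EuclideanSpace ℂ ι) (lam : ℝ) :
    Matrix ι ι ℂ :=
  pureProj Ψ + (lam : ℂ) • (1 - pureProj Ψ)

/-- `Ω^{⊗ (N - i)} ⊗ (1 - Ω)^{⊗ i} ⊗ E` on `(ℂ^ι)^{⊗ (N + 1)}`: the first `N - i` systems pass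
the test, the next `i` systems fail it, and `E` acts on the last system (used for `i ≤ N`). -/
noncomputable def testOp {ι : Type*} [DecidableEq ι] (Ψ : EuclideanSpace ℂ ι) (lam : ℝ)
    (N i : ℕ) (E : Matrix ι ι ℂ) :
    Matrix (Fin (N + 1) → ι) (Fin (N + 1) → ι) ℂ :=
  tensorOp fun j =>
    if (j : ℕ) < N - i then strategy Ψ lam
    else if (j : ℕ) < N then 1 - strategy Ψ lam
    else E

/-- Permutation-invariant density operators on `(ℂ^ι)^{⊗ n}`: positive semidefinite matrices of
trace one that are unchanged when the `n` tensor factors are permuted. -/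
structure IsPermInvState {ι : Type*} [Fintype ι] {n : ℕ}
    (ρ : Matrix (Fin n → ι) (Fin n → ι) ℂ) : Prop where
  posSemidef : ρ.PosSemidef
  trace_eq_one : ρ.trace = 1
  perm_inv : ∀ (π : Equiv.Perm (Fin n)) (x y : Fin n → ι), ρ (x ∘ π) (y ∘ π) = ρ x y

/-- `p_k(ρ)`: the probability that at most `k` of the `N` tests on the first `N` systems of the
permutation-invariant state `ρ` fail, i.e. that `ρ` is accepted. -/
noncomputable def acceptProb {ι : Type*} [Fintype ι] [DecidableEq ι]
    (Ψ : EuclideanSpace ℂ ι) (lam : ℝ) (k N : ℕ)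
    (ρ : Matrix (Fin (N + 1) → ι) (Fin (N + 1) → ι) ℂ) : ℝ :=
  ∑ i ∈ Finset.range (k + 1), (N.choose i : ℝ) * (testOp Ψ lam N i 1 * ρ).trace.re

/-- `f_k(ρ)`: the joint probability of accepting `ρ` and finding the last system in the
target state `Ψ`. -/
noncomputable def acceptTargetProb {ι : Type*} [Fintype ι] [DecidableEq ι]
    (Ψ : EuclideanSpace ℂ ι) (lam : ℝ) (k N : ℕ)
    (ρ : Matrix (Fin (N + 1) → ι) (Fin (N + 1) → ι) ℂ) : ℝ :=
  ∑ i ∈ Finset.range (k + 1),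
    (N.choose i : ℝ) * (testOp Ψ lam N i (pureProj Ψ) * ρ).trace.re

/-- `F_k(ρ) = f_k(ρ) / p_k(ρ)`: the fidelity between the target state and the reduced state of the
last system given acceptance (meaningful when `p_k(ρ) > 0`). -/
noncomputable def condFidelity {ι : Type*} [Fintype ι] [DecidableEq ι]
    (Ψ : EuclideanSpace ℂ ι) (lam : ℝ) (k N : ℕ)
    (ρ : Matrix (Fin (N + 1) → ι) (Fin (N + 1) → ι) ℂ) : ℝ :=
  acceptTargetProb Ψ lam k N ρ / acceptProb Ψ lam k N ρ

/-- The set `{F_k(ρ) | p_k(ρ) ≥ δ}`, with `ρ` ranging over the permutation-invariant states of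
`N + 1` systems. -/
def fidelitySet {ι : Type*} [Fintype ι] [DecidableEq ι]
    (Ψ : EuclideanSpace ℂ ι) (lam : ℝ) (k N : ℕ) (δ : ℝ) : Set ℝ :=
  {F | ∃ ρ : Matrix (Fin (N + 1) → ι) (Fin (N + 1) → ι) ℂ,
    IsPermInvState ρ ∧ δ ≤ acceptProb Ψ lam k N ρ ∧ F = condFidelity Ψ lam k N ρ}

/-- The guaranteed infidelity `1 - min {F_k(ρ) | p_k(ρ) ≥ δ}` in the adversarial scenario. -/
noncomputable def guaranteedInfidelity {ι : Type*} [Fintype ι] [DecidableEq ι]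
    (Ψ : EuclideanSpace ℂ ι) (lam : ℝ) (k N : ℕ) (δ : ℝ) : ℝ :=
  1 - sInf (fidelitySet Ψ lam k N δ)

/-- The numbers `N ≥ k + 1` of tests that reach infidelity `ε` with significance level `δ`, when
`k` failures are allowed. -/
def sufficientTests {ι : Type*} [Fintype ι] [DecidableEq ι]
    (Ψ : EuclideanSpace ℂ ι) (k : ℕ) (ε δ lam : ℝ) : Set ℕ :=
  {N | k + 1 ≤ N ∧ guaranteedInfidelity Ψ lam k N δ ≤ ε}

/-- The minimum number `N_k(ε, δ, lam)` of tests. -/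
noncomputable def minTests {ι : Type*} [Fintype ι] [DecidableEq ι]
    (Ψ : EuclideanSpace ℂ ι) (k : ℕ) (ε δ lam : ℝ) : ℕ :=
  sInf (sufficientTests Ψ k ε δ lam)

/-! Write `P = pureProj Ψ`, `Q = 1 - P`. Then `Ω = P + λQ` and `1 - Ω = νQ`, so a
permutation-invariant state enters only through the law `c j` of the number `j` of systems found in
`Q`. Conversely, dimension at least two makes every law on `0, …, N + 1` realizable. Hence `f_k` and
`p_k` are averages over `c` of `goodWeight` and of `h j = badWeight + goodWeight`, built from the
binomial lower tail `F j = failCDF lam j k`. The fidelity set is therefore a continuous image of a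
compact part of a simplex, and the inner minimum exists (`fidelitySet_eq_image`,
`isLeast_fidelitySet`).

Upper bounds follow from weak linear programming duality: it suffices to find `μ ≥ 0` with `bad j -
ε h j ≤ μ (δ - h j)` for all `j` (`mem_sufficientTests_of_multiplier`). Two estimates produce `μ` in
`exists_multiplier`. First, `λ j F (j - 1) / F j` is the mean number of passes given at most `k`
failures; bounding it bounds the conditional infidelity by a linear-fractional function of `j`,
which is replaced by its tangent where it equals `ε`. Second, Chernoff's bound makes `h j` decay
exponentially, and `1 + u ≤ exp u` turns this into a bound linear in `j`. The variance proxies `1/4`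
and `λν` give the two upper bounds, and nonemptiness gives the minimum over `N`.

Lower bounds come from test states. Independent systems, each in `Q` with probability `q ≈ k /
(νN)`, are accepted with probability at least `1/2 ≥ δ`, because a binomial variable of mean at most
the integer `k` is at most `k` with probability at least one half (`half_le_failCDF`); their
fidelity is `1 - q`. A state with exactly `⌊ln δ / ln λ⌋` systems in `Q` is accepted with
probability at least `δ`, and its infidelity is bounded below using that, given at most `k`
failures, at least `j - k` of `j` tests pass. -/

/-! ### Binomial lower tails and their conditional moments. -/

/-- The probability of exactly `i` failures when `m` systems orthogonal to the target are tested and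
each of them passes with probability `lam`. -/
noncomputable def failPMF (lam : ℝ) (m i : ℕ) : ℝ :=
  (m.choose i : ℝ) * (1 - lam) ^ i * lam ^ (m - i)

/-- The probability of at most `k` failures when `m` systems orthogonal to the target are tested. -/
noncomputable def failCDF (lam : ℝ) (m k : ℕ) : ℝ :=
  ∑ i ∈ Finset.range (k + 1), failPMF lam m i

lemma failPMF_nonneg {lam : ℝ} (h0 : 0 ≤ lam) (h1 : lam ≤ 1) (m i : ℕ) :
    0 ≤ failPMF lam m i := by
  unfold failPMF
  have : 0 ≤ 1 - lam := by linarith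
  positivity

lemma failPMF_succ_zero (lam : ℝ) (m : ℕ) : failPMF lam (m + 1) 0 = lam * failPMF lam m 0 := by
  simp [failPMF, pow_succ, mul_comm]

lemma failPMF_succ_succ (lam : ℝ) (m i : ℕ) :
    failPMF lam (m + 1) (i + 1) = (1 - lam) * failPMF lam m i + lam * failPMF lam m (i + 1) := by
  unfold failPMF
  rw [Nat.choose_succ_succ, Nat.add_sub_add_right]
  rcases lt_or_ge i m with h | h
  · have h2 : m - i = m - (i + 1) + 1 := by omega
    rw [h2]; push_cast; ring
  · rw [Nat.choose_eq_zero_of_lt (by omega : m < i + 1)]; push_cast; ring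

/-- Removing one pass: `(j - i) b(j, i) = λ j b(j - 1, i)`. -/
lemma sub_mul_failPMF_succ (lam : ℝ) (m i : ℕ) :
    ((m : ℝ) + 1 - i) * failPMF lam (m + 1) i = lam * (m + 1) * failPMF lam m i := by
  unfold failPMF
  rcases le_or_gt i m with h | h
  · have e : ((m.choose i : ℕ) : ℝ) * (m + 1) = ((m + 1).choose i : ℝ) * ((m : ℝ) + 1 - i) := by
      have := Nat.choose_mul_succ_eq m i
      have h3 : ((m + 1 - i : ℕ) : ℝ) = (m : ℝ) + 1 - i := by
        rw [Nat.cast_sub (by omega)]; push_cast; ring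
      rw [← h3]; exact_mod_cast this
    have h2 : m + 1 - i = m - i + 1 := by omega
    rw [h2, pow_succ]
    linear_combination (-(1 - lam) ^ i * lam ^ (m - i) * lam) * e
  · rw [Nat.choose_eq_zero_of_lt h]
    rcases eq_or_lt_of_le (Nat.succ_le_of_lt h) with h | h
    · subst h; push_cast; ring
    · rw [Nat.choose_eq_zero_of_lt h]; simp

/-- Turning a pass into a failure: `(i + 1) λ b(m, i + 1) = (m - i) ν b(m, i)`. -/
lemma succ_mul_failPMF (lam : ℝ) (m i : ℕ) :
    ((i : ℝ) + 1) * lam * failPMF lam m (i + 1) = ((m : ℝ) - i) * (1 - lam) * failPMF lam m i := by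
  unfold failPMF
  rcases lt_or_ge i m with h | h
  · have e : ((m.choose (i + 1) : ℕ) : ℝ) * (i + 1) = (m.choose i : ℝ) * ((m : ℝ) - i) := by
      have := Nat.choose_succ_right_eq m i
      rw [← Nat.cast_sub h.le]; exact_mod_cast this
    have h2 : m - i = m - (i + 1) + 1 := by omega
    rw [h2, pow_succ, pow_succ]
    linear_combination ((1 - lam) ^ i * lam ^ (m - (i + 1)) * lam * (1 - lam)) * e
  · rw [Nat.choose_eq_zero_of_lt (by omega : m < i + 1)]
    rcases eq_or_lt_of_le h with h | h
    · subst h; simp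
    · rw [Nat.choose_eq_zero_of_lt h]; simp

lemma failCDF_zero (lam : ℝ) (k : ℕ) : failCDF lam 0 k = 1 := by
  unfold failCDF
  rw [Finset.sum_range_succ', Finset.sum_eq_zero]
  · simp [failPMF]
  · intro i _; simp [failPMF]

/-- One further test lowers the acceptance probability by `ν b(m, k)`. -/
lemma failCDF_succ (lam : ℝ) (m k : ℕ) :
    failCDF lam (m + 1) k = failCDF lam m k - (1 - lam) * failPMF lam m k := by
  induction k with
  | zero => simp [failCDF, failPMF_succ_zero]; ring
  | succ k ih =>
    unfold failCDF at ih ⊢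
    rw [Finset.sum_range_succ, ih, Finset.sum_range_succ _ (k + 1), failPMF_succ_succ]; ring

lemma failCDF_succ_succ (lam : ℝ) (m k : ℕ) :
    failCDF lam (m + 1) (k + 1) = (1 - lam) * failCDF lam m k + lam * failCDF lam m (k + 1) := by
  rw [failCDF_succ]
  have : failCDF lam m (k + 1) = failCDF lam m k + failPMF lam m (k + 1) := by
    unfold failCDF; rw [Finset.sum_range_succ]
  rw [this]; ring

lemma failCDF_succ_le {lam : ℝ} (h0 : 0 ≤ lam) (h1 : lam ≤ 1) (m k : ℕ) :
    failCDF lam (m + 1) k ≤ failCDF lam m k := by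
  rw [failCDF_succ]
  have := mul_nonneg (sub_nonneg.2 h1) (failPMF_nonneg h0 h1 m k)
  linarith

lemma failCDF_le_one {lam : ℝ} (h0 : 0 ≤ lam) (h1 : lam ≤ 1) (m k : ℕ) :
    failCDF lam m k ≤ 1 := by
  induction m with
  | zero => rw [failCDF_zero]
  | succ m ih => exact (failCDF_succ_le h0 h1 m k).trans ih

lemma pow_le_failCDF {lam : ℝ} (h0 : 0 ≤ lam) (h1 : lam ≤ 1) (m k : ℕ) :
    lam ^ m ≤ failCDF lam m k := by
  have : failPMF lam m 0 = lam ^ m := by simp [failPMF]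
  rw [← this]
  exact Finset.single_le_sum (fun i _ => failPMF_nonneg h0 h1 m i) (by simp)

lemma failCDF_pos {lam : ℝ} (h0 : 0 < lam) (h1 : lam ≤ 1) (m k : ℕ) : 0 < failCDF lam m k :=
  (pow_pos h0 m).trans_le (pow_le_failCDF h0.le h1 m k)

/-- The mean number of passes, restricted to the event of at most `k` failures. -/
lemma sum_sub_mul_failPMF (lam : ℝ) (m k : ℕ) :
    ∑ i ∈ Finset.range (k + 1), ((m : ℝ) + 1 - i) * failPMF lam (m + 1) i
      = lam * (m + 1) * failCDF lam m k := by
  simp_rw [sub_mul_failPMF_succ, failCDF, Finset.mul_sum]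

/-- With at most `k` failures among `m + 1` tests there are at least `m + 1 - k` passes; the right
side is the mean number of passes on that event. -/
lemma sub_mul_failCDF_succ_le {lam : ℝ} (h0 : 0 ≤ lam) (h1 : lam ≤ 1) (m k : ℕ) :
    ((m : ℝ) + 1 - k) * failCDF lam (m + 1) k ≤ lam * (m + 1) * failCDF lam m k := by
  rw [← sum_sub_mul_failPMF, failCDF, Finset.mul_sum]
  refine Finset.sum_le_sum fun i hi => mul_le_mul_of_nonneg_right ?_ (failPMF_nonneg h0 h1 _ _)
  have : (i : ℝ) ≤ k := by exact_mod_cast Nat.lt_succ_iff.1 (Finset.mem_range.1 hi)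
  linarith

/-- The second moment of the distance to `k`, restricted to the event of at most `k` failures. -/
lemma sum_sq_mul_failPMF (lam : ℝ) (m k : ℕ) :
    ∑ i ∈ Finset.range (k + 1), ((k : ℝ) - i) ^ 2 * failPMF lam m i
      = lam * k * failCDF lam m k - (lam + (1 - lam) * m - k) *
        ∑ i ∈ Finset.range (k + 1), ((k : ℝ) - i) * failPMF lam m i := by
  -- Summation by parts: the ratio identity for consecutive terms is multiplied by `k - i` and
  -- summed. Both boundary terms vanish, at `i = 0` through the factor `i` and at `i = k` through
  -- the factor `k - i`.
  have key : ∑ i ∈ Finset.range (k + 1), ((k : ℝ) - i + 1) * i * lam * failPMF lam m i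
      = ∑ i ∈ Finset.range (k + 1), ((k : ℝ) - i) * (m - i) * (1 - lam) * failPMF lam m i := by
    rw [Finset.sum_range_succ', Finset.sum_range_succ]
    simp only [Nat.cast_zero, mul_zero, zero_mul, add_zero, sub_self]
    refine Finset.sum_congr rfl fun i _ => ?_
    have := succ_mul_failPMF lam m i
    push_cast
    linear_combination ((k : ℝ) - i) * this
  rw [failCDF, Finset.mul_sum, Finset.mul_sum, ← Finset.sum_sub_distrib, ← sub_eq_zero,
    ← Finset.sum_sub_distrib]
  rw [← sub_eq_zero, ← Finset.sum_sub_distrib] at key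
  rw [← neg_eq_zero, ← Finset.sum_neg_distrib, ← key]
  exact Finset.sum_congr rfl fun i _ => by ring

/-- When the mean `νm` is at least `k`, the second-moment identity bounds the conditional mean
square of `k - i` by `λk`; Cauchy–Schwarz, in the form `2σa ≤ a² + σ²`, then bounds the conditional
mean by `σ`. -/
lemma sum_sub_mul_failPMF_le {lam : ℝ} (h0 : 0 < lam) (h1 : lam ≤ 1) {m k : ℕ}
    (hm : (k : ℝ) ≤ (1 - lam) * m) :
    ∑ i ∈ Finset.range (k + 1), ((k : ℝ) - i) * failPMF lam m i
      ≤ Real.sqrt (lam * k) * failCDF lam m k := by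
  have hnn : ∀ i ∈ Finset.range (k + 1), 0 ≤ ((k : ℝ) - i) * failPMF lam m i := fun i hi => by
    have : (i : ℝ) ≤ k := by exact_mod_cast Nat.lt_succ_iff.1 (Finset.mem_range.1 hi)
    exact mul_nonneg (by linarith) (failPMF_nonneg h0.le h1 _ _)
  rcases Nat.eq_zero_or_pos k with rfl | hk
  · simp
  set σ := Real.sqrt (lam * k) with hσ
  have hσ2 : σ ^ 2 = lam * k := Real.sq_sqrt (by positivity)
  have hσ0 : 0 < σ := Real.sqrt_pos.2 (by positivity)
  have h2 := sum_sq_mul_failPMF lam m k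
  have hS := Finset.sum_nonneg hnn
  set S := ∑ i ∈ Finset.range (k + 1), ((k : ℝ) - i) * failPMF lam m i with hSdef
  have h3 : 2 * σ * S ≤ ∑ i ∈ Finset.range (k + 1), ((k : ℝ) - i) ^ 2 * failPMF lam m i
      + σ ^ 2 * failCDF lam m k := by
    rw [hSdef, failCDF, Finset.mul_sum, Finset.mul_sum, ← Finset.sum_add_distrib]
    refine Finset.sum_le_sum fun i _ => ?_
    nlinarith [mul_nonneg (sq_nonneg ((k : ℝ) - i - σ)) (failPMF_nonneg h0.le h1 m i)]
  have h4 : 0 ≤ (lam + (1 - lam) * m - k) * S := mul_nonneg (by linarith) hS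
  have h5 : 2 * σ * S ≤ 2 * σ * (σ * failCDF lam m k) := by
    rw [← hσ2] at h2
    linarith
  exact le_of_mul_le_mul_left h5 (by positivity)

/-- The conditional mean number of passes, for many tests. -/
lemma mul_failCDF_le_of_le {lam : ℝ} (h0 : 0 < lam) (h1 : lam ≤ 1) {m k : ℕ}
    (hm : (k : ℝ) ≤ (1 - lam) * (m + 1)) :
    lam * (m + 1) * failCDF lam m k
      ≤ (m + 1 - k + Real.sqrt (lam * k)) * failCDF lam (m + 1) k := by
  have h := sum_sub_mul_failPMF_le h0 h1 (m := m + 1) (k := k) (by push_cast; exact hm)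
  rw [← sum_sub_mul_failPMF]
  have e : ∑ i ∈ Finset.range (k + 1), ((m : ℝ) + 1 - i) * failPMF lam (m + 1) i
      = (m + 1 - k) * failCDF lam (m + 1) k
        + ∑ i ∈ Finset.range (k + 1), ((k : ℝ) - i) * failPMF lam (m + 1) i := by
    rw [failCDF, Finset.mul_sum, ← Finset.sum_add_distrib]
    exact Finset.sum_congr rfl fun i _ => by ring
  rw [e]; linarith

lemma failPMF_le_succ {lam : ℝ} (h0 : 0 < lam) (h1 : lam ≤ 1) {m k : ℕ}
    (hm : (1 - lam) * (m + 1) ≤ k) : failPMF lam m k ≤ failPMF lam (m + 1) k := by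
  have h := sub_mul_failPMF_succ lam m k
  have hb := failPMF_nonneg h0.le h1 m k
  have hb' := failPMF_nonneg h0.le h1 (m + 1) k
  rcases lt_or_ge m k with hmk | hmk
  · have : failPMF lam m k = 0 := by simp [failPMF, Nat.choose_eq_zero_of_lt hmk]
    rw [this]; exact hb'
  · have hmk' : (k : ℝ) ≤ m := by exact_mod_cast hmk
    have h2 : ((m : ℝ) + 1 - k) * failPMF lam m k ≤ ((m : ℝ) + 1 - k) * failPMF lam (m + 1) k := by
      rw [h]; exact mul_le_mul_of_nonneg_right (by linarith) hb
    exact le_of_mul_le_mul_left h2 (by linarith)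

/-- Log-concavity in the number of tests: the decrements of `failCDF` are `ν b(m, k)`, and these
increase with `m` as long as `ν(m + 1) ≤ k`. -/
lemma failCDF_mul_le_sq {lam : ℝ} (h0 : 0 < lam) (h1 : lam ≤ 1) {m k : ℕ}
    (hm : (1 - lam) * (m + 1) ≤ k) :
    failCDF lam m k * failCDF lam (m + 2) k ≤ failCDF lam (m + 1) k ^ 2 := by
  have hb := failPMF_nonneg h0.le h1 m k
  have hc := failPMF_le_succ h0 h1 hm
  have hB := failCDF_pos h0 h1 (m + 1) k
  have e1 := failCDF_succ lam m k
  have e2 := failCDF_succ lam (m + 1) k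
  have e3 : failCDF lam m k = failCDF lam (m + 1) k + (1 - lam) * failPMF lam m k := by linarith
  have hν : 0 ≤ 1 - lam := by linarith
  rw [show m + 2 = m + 1 + 1 from rfl, e2, e3]
  have p1 : 0 ≤ (1 - lam) * failCDF lam (m + 1) k * (failPMF lam (m + 1) k - failPMF lam m k) :=
    mul_nonneg (by positivity) (by linarith)
  have p2 : 0 ≤ ((1 - lam) * failPMF lam m k) * ((1 - lam) * failPMF lam (m + 1) k) :=
    mul_nonneg (mul_nonneg hν hb) (mul_nonneg hν (hb.trans hc))
  nlinarith

/-- The conditional mean number of passes, for few tests. -/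
lemma mul_failCDF_le_of_ge {lam : ℝ} (h0 : 0 < lam) (h1 : lam < 1) {m k : ℕ}
    (hm : (m : ℝ) ≤ k / (1 - lam)) :
    lam * (m + 1) * failCDF lam m k
      ≤ (k / (1 - lam) + 1 - k + Real.sqrt (lam * k)) * failCDF lam (m + 1) k := by
  have hν : 0 < 1 - lam := by linarith
  set a := (k : ℝ) / (1 - lam) + 1 - k + Real.sqrt (lam * k) with ha
  have base : ∀ m : ℕ, (k : ℝ) ≤ (1 - lam) * (m + 1) → (m : ℝ) ≤ k / (1 - lam) →
      lam * (m + 1) * failCDF lam m k ≤ a * failCDF lam (m + 1) k := fun m h h' =>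
    (mul_failCDF_le_of_le h0 h1.le h).trans
      (mul_le_mul_of_nonneg_right (by linarith) (failCDF_pos h0 h1.le _ _).le)
  -- Log-concavity makes `λ(m + 1) F m / F (m + 1)` increase with `m` here, so it is bounded by its
  -- value at `⌊k/ν⌋`, where the estimate for many tests applies. The induction descends from that
  -- point.
  obtain ⟨d, hd⟩ : ∃ d, m + d = ⌊(k : ℝ) / (1 - lam)⌋₊ :=
    ⟨_, Nat.add_sub_cancel' (Nat.le_floor hm)⟩
  induction d generalizing m with
  | zero =>
    refine base m ?_ hm
    have := Nat.lt_floor_add_one ((k : ℝ) / (1 - lam))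
    rw [← hd, div_lt_iff₀ hν] at this
    push_cast at this
    linarith
  | succ d ih =>
    have hle : ((m + 1 : ℕ) : ℝ) ≤ k / (1 - lam) :=
      (Nat.le_floor_iff (by positivity)).1 (by omega)
    have h2 := ih hle (by omega)
    rw [le_div_iff₀ hν] at hle
    push_cast at hle h2
    have hlc := failCDF_mul_le_sq h0 h1.le (m := m) (k := k) (by linarith)
    have hB2 := failCDF_pos h0 h1.le (m + 2) k
    have hB1 := failCDF_pos h0 h1.le (m + 1) k
    refine le_of_mul_le_mul_right ?_ hB2
    calc lam * (m + 1) * failCDF lam m k * failCDF lam (m + 2) k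
        = lam * (m + 1) * (failCDF lam m k * failCDF lam (m + 2) k) := by ring
      _ ≤ lam * (m + 1) * failCDF lam (m + 1) k ^ 2 := by gcongr
      _ ≤ lam * (m + 1 + 1) * failCDF lam (m + 1) k ^ 2 := by gcongr; linarith
      _ = (lam * (m + 1 + 1) * failCDF lam (m + 1) k) * failCDF lam (m + 1) k := by ring
      _ ≤ (a * failCDF lam (m + 1 + 1) k) * failCDF lam (m + 1) k := by gcongr
      _ = a * failCDF lam (m + 1) k * failCDF lam (m + 2) k := by ring

/-! ### Chernoff's bound for the lower tail. -/

/-- Markov's inequality for `exp (-θ i)`, obtained by conditioning on one test at a time instead of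
from the moment generating function. -/
lemma failCDF_le_exp_mul_pow {lam θ : ℝ} (h0 : 0 ≤ lam) (h1 : lam ≤ 1) (hθ : 0 ≤ θ) (m k : ℕ) :
    failCDF lam m k ≤ Real.exp (θ * k) * (lam + (1 - lam) * Real.exp (-θ)) ^ m := by
  have hν : 0 ≤ 1 - lam := by linarith
  induction m generalizing k with
  | zero => rw [failCDF_zero]; simpa using by positivity
  | succ m ih =>
    cases k with
    | zero =>
      have e : failCDF lam (m + 1) 0 = lam * failCDF lam m 0 := by
        simp [failCDF, failPMF_succ_zero]
      have hz : lam ≤ lam + (1 - lam) * Real.exp (-θ) := by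
        have := mul_nonneg hν (Real.exp_pos (-θ)).le; linarith
      calc failCDF lam (m + 1) 0 = lam * failCDF lam m 0 := e
        _ ≤ lam * (Real.exp (θ * (0 : ℕ)) * (lam + (1 - lam) * Real.exp (-θ)) ^ m) := by
            gcongr; exact ih 0
        _ ≤ (lam + (1 - lam) * Real.exp (-θ))
              * (Real.exp (θ * (0 : ℕ)) * (lam + (1 - lam) * Real.exp (-θ)) ^ m) := by gcongr
        _ = _ := by ring
    | succ k =>
      have e : Real.exp (θ * k) = Real.exp (θ * (k + 1 : ℕ)) * Real.exp (-θ) := by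
        rw [← Real.exp_add]; congr 1; push_cast; ring
      calc failCDF lam (m + 1) (k + 1)
          = (1 - lam) * failCDF lam m k + lam * failCDF lam m (k + 1) := failCDF_succ_succ ..
        _ ≤ (1 - lam) * (Real.exp (θ * k) * (lam + (1 - lam) * Real.exp (-θ)) ^ m)
            + lam * (Real.exp (θ * (k + 1 : ℕ)) * (lam + (1 - lam) * Real.exp (-θ)) ^ m) := by
            gcongr
            · exact ih k
            · exact ih (k + 1)
        _ = _ := by rw [e]; ring

/-- A quadratic bound for the cumulant generating function of a Bernoulli variable. -/
lemma add_mul_exp_neg_le {lam C θ : ℝ} (h0 : 0 < lam) (h1 : lam ≤ 1) (hθ : 0 ≤ θ)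
    (hC : ∀ z : ℝ, 0 < z → z ≤ 1 → lam * (1 - lam) * z ≤ C * (lam + (1 - lam) * z) ^ 2) :
    lam + (1 - lam) * Real.exp (-θ) ≤ Real.exp (-((1 - lam) * θ - C * θ ^ 2 / 2)) := by
  have hν : 0 ≤ 1 - lam := by linarith
  have hpos : ∀ x : ℝ, 0 < lam + (1 - lam) * Real.exp (-x) := fun x => by positivity
  set g : ℝ → ℝ := fun x => -(1 - lam) + C * x
    + (1 - lam) * Real.exp (-x) / (lam + (1 - lam) * Real.exp (-x)) with hg
  set f : ℝ → ℝ := fun x => -(1 - lam) * x + C * x ^ 2 / 2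
    - Real.log (lam + (1 - lam) * Real.exp (-x)) with hf
  have hexp : ∀ x : ℝ, HasDerivAt (fun x : ℝ => Real.exp (-x)) (-Real.exp (-x)) x := fun x => by
    simpa using (hasDerivAt_neg x).exp
  have hz : ∀ x : ℝ, HasDerivAt (fun x : ℝ => lam + (1 - lam) * Real.exp (-x))
      ((1 - lam) * -Real.exp (-x)) x := fun x => ((hexp x).const_mul _).const_add _
  have hfd : ∀ x, HasDerivAt f (g x) x := fun x => by
    have := ((((hasDerivAt_id x).const_mul (-(1 - lam))).add
      ((((hasDerivAt_id x).pow 2).const_mul C).div_const 2)).sub ((hz x).log (hpos x).ne'))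
    refine this.congr_deriv ?_
    simp only [hg, id]; push_cast; ring
  -- The second derivative of the cumulant generating function is `λνz / (λ + νz)²` with `z = exp
  -- (-x)`. Since only `x > 0` matters, `hC` is needed only for `z ≤ 1`, which is what admits `C =
  -- λν` when `λ ≥ 1/2`.
  have hgd : ∀ x, HasDerivAt g (C - lam * (1 - lam) * Real.exp (-x)
      / (lam + (1 - lam) * Real.exp (-x)) ^ 2) x := fun x => by
    have := ((((hasDerivAt_id x).const_mul C).const_add (-(1 - lam)))).add
      (((hexp x).const_mul (1 - lam)).div (hz x) (hpos x).ne')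
    refine this.congr_deriv ?_
    have := (hpos x).ne'
    field_simp
    ring
  have mono : ∀ (u u' : ℝ → ℝ), (∀ x, HasDerivAt u (u' x) x) → (∀ x, 0 < x → 0 ≤ u' x) →
      u 0 = 0 → ∀ x, 0 ≤ x → 0 ≤ u x := fun u u' hu hu' hu0 x hx => by
    have : MonotoneOn u (Set.Ici 0) := monotoneOn_of_deriv_nonneg (convex_Ici 0)
      (fun x _ => (hu x).continuousAt.continuousWithinAt)
      (fun x _ => (hu x).differentiableAt.differentiableWithinAt)
      (fun x hx => by rw [(hu x).deriv]; exact hu' x (by simpa using hx))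
    have := this (Set.mem_Ici.2 le_rfl) (Set.mem_Ici.2 hx) hx
    rwa [hu0] at this
  have hg0 : ∀ x, 0 ≤ x → 0 ≤ g x := mono g _ hgd (fun x hx => by
    rw [sub_nonneg, div_le_iff₀ (by have := hpos x; positivity)]
    exact hC _ (Real.exp_pos _) (Real.exp_le_one_iff.2 (by linarith))) (by simp [hg])
  have hf0 := mono f g hfd (fun x hx => hg0 x hx.le) (by simp [hf]) θ hθ
  rw [← Real.log_le_iff_le_exp (hpos θ)]
  simp only [hf] at hf0
  linarith

/-- Chernoff's bound for the acceptance probability. -/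
lemma failCDF_le_exp {lam C θ : ℝ} (h0 : 0 < lam) (h1 : lam ≤ 1) (hθ : 0 ≤ θ)
    (hC : ∀ z : ℝ, 0 < z → z ≤ 1 → lam * (1 - lam) * z ≤ C * (lam + (1 - lam) * z) ^ 2)
    (m k : ℕ) :
    failCDF lam m k ≤ Real.exp (θ * k - ((1 - lam) * θ - C * θ ^ 2 / 2) * m) := by
  have hν : 0 ≤ 1 - lam := by linarith
  refine (failCDF_le_exp_mul_pow h0.le h1 hθ m k).trans ?_
  rw [sub_eq_add_neg (θ * k), Real.exp_add]
  gcongr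
  calc (lam + (1 - lam) * Real.exp (-θ)) ^ m
      ≤ Real.exp (-((1 - lam) * θ - C * θ ^ 2 / 2)) ^ m := by
        gcongr; exact add_mul_exp_neg_le h0 h1 hθ hC
    _ = _ := by rw [← Real.exp_nat_mul]; congr 1; ring

/-! ### The dual certificate for the upper bounds. -/

/-- The probability of acceptance with a last system in the target state when `j` of the `N + 1`
systems, placed uniformly at random, are orthogonal to the target. -/
noncomputable def goodWeight (lam : ℝ) (k N j : ℕ) : ℝ :=
  (N + 1 - j) * failCDF lam j k / (N + 1)

/-- The probability of acceptance with a last system orthogonal to the target when `j` of the `N + 1`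
systems, placed uniformly at random, are orthogonal to the target. -/
noncomputable def badWeight (lam : ℝ) (k N j : ℕ) : ℝ :=
  j * failCDF lam (j - 1) k / (N + 1)

lemma goodWeight_nonneg {lam : ℝ} (h0 : 0 < lam) (h1 : lam ≤ 1) {k N j : ℕ} (hj : j ≤ N + 1) :
    0 ≤ goodWeight lam k N j := by
  have : (j : ℝ) ≤ N + 1 := by exact_mod_cast hj
  exact div_nonneg (mul_nonneg (by linarith) (failCDF_pos h0 h1 _ _).le) (by positivity)

lemma badWeight_nonneg {lam : ℝ} (h0 : 0 < lam) (h1 : lam ≤ 1) (k N j : ℕ) :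
    0 ≤ badWeight lam k N j :=
  div_nonneg (mul_nonneg (by positivity) (failCDF_pos h0 h1 _ _).le) (by positivity)

lemma badWeight_add_goodWeight_le {lam : ℝ} (h0 : 0 < lam) (h1 : lam ≤ 1) {k N j : ℕ}
    (hj : j ≤ N + 1) : badWeight lam k N j + goodWeight lam k N j ≤ failCDF lam (j - 1) k := by
  have hj' : (j : ℝ) ≤ N + 1 := by exact_mod_cast hj
  have hle : failCDF lam j k ≤ failCDF lam (j - 1) k := by
    cases j with
    | zero => exact le_rfl
    | succ j => exact failCDF_succ_le h0.le h1 _ _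
  unfold badWeight goodWeight
  rw [← add_div, div_le_iff₀ (by positivity)]
  have := mul_le_mul_of_nonneg_left hle (sub_nonneg.2 hj')
  linarith

lemma failCDF_le_badWeight_add_goodWeight {lam : ℝ} (h0 : 0 < lam) (h1 : lam ≤ 1) (k N j : ℕ) :
    failCDF lam j k ≤ badWeight lam k N j + goodWeight lam k N j := by
  have hle : failCDF lam j k ≤ failCDF lam (j - 1) k := by
    cases j with
    | zero => exact le_rfl
    | succ j => exact failCDF_succ_le h0.le h1 _ _
  unfold badWeight goodWeight
  rw [← add_div, le_div_iff₀ (by positivity)]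
  have := mul_le_mul_of_nonneg_left hle (Nat.cast_nonneg (α := ℝ) j)
  linarith

/-- The exponential tilt for which Chernoff's bound at the point `x + t` is at most `exp (-L)`. -/
lemma exists_chernoff_parameter {ν C t x L : ℝ} (hν : 0 < ν) (hC : 0 < C) (ht : 0 < t) (hx : 0 ≤ x)
    (h : 2 * C * L * (x + t) ≤ ν ^ 2 * t ^ 2) :
    ∃ θ s : ℝ, 0 < θ ∧ 0 < s ∧ s = ν * θ - C * θ ^ 2 / 2 ∧ L + θ * (ν * x) ≤ s * (x + t) := by
  have hm0 : 0 < x + t := by positivity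
  -- This `θ` minimizes the exponent `θνx - (νθ - Cθ²/2)(x + t)`, with minimum `-ν²t² / (2C(x +
  -- t))`.
  refine ⟨ν * t / (C * (x + t)), _, by positivity, ?_, rfl, ?_⟩
  · have : ν * (ν * t / (C * (x + t))) - C * (ν * t / (C * (x + t))) ^ 2 / 2
        = ν ^ 2 * t * (x + t / 2) / (C * (x + t) ^ 2) := by
      field_simp; ring
    rw [this]; positivity
  · have : (ν * (ν * t / (C * (x + t))) - C * (ν * t / (C * (x + t))) ^ 2 / 2) * (x + t)
        = ν ^ 2 * t ^ 2 / (2 * C * (x + t)) + ν * t / (C * (x + t)) * (ν * x) := by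
      field_simp; ring
    rw [this]
    gcongr
    rw [le_div_iff₀ (by positivity)]
    linarith

set_option maxHeartbeats 400000 in
/-- A multiplier which certifies that infidelity `ε` is reached with significance level `δ`. -/
lemma exists_multiplier {lam ε δ C t : ℝ} {k N : ℕ} (h0 : 0 < lam) (h1 : lam < 1)
    (hε0 : 0 < ε) (hε1 : ε < 1) (hδ0 : 0 < δ) (hC0 : 0 < C) (ht : 0 < t)
    (hC : ∀ z : ℝ, 0 < z → z ≤ 1 → lam * (1 - lam) * z ≤ C * (lam + (1 - lam) * z) ^ 2)
    (htL : 2 * C * Real.log δ⁻¹ * (k / (1 - lam) + t) ≤ (1 - lam) ^ 2 * t ^ 2)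
    (hN : lam * (k / (1 - lam)) + Real.sqrt (lam * k) + t + 1 ≤ ε * lam * (N + 1)) :
    ∃ μ : ℝ, 0 ≤ μ ∧ ∀ j : ℕ, j ≤ N + 1 →
      badWeight lam k N j - ε * (badWeight lam k N j + goodWeight lam k N j)
        ≤ μ * (δ - (badWeight lam k N j + goodWeight lam k N j)) := by
  obtain ⟨ν, hν⟩ : ∃ ν, ν = 1 - lam := ⟨_, rfl⟩
  have hν0 : 0 < ν := by linarith
  obtain ⟨x, hx⟩ : ∃ x : ℝ, x = k / ν := ⟨_, rfl⟩
  have hxk : ν * x = k := by rw [hx]; field_simp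
  have hx0 : 0 ≤ x := by rw [hx]; positivity
  have hxdef : (k : ℝ) / (1 - lam) = x := by rw [hx, hν]
  rw [hxdef, ← hν] at htL
  rw [hxdef] at hN
  set σ := Real.sqrt (lam * k) with hσ
  have hσ0 : 0 ≤ σ := Real.sqrt_nonneg _
  set M : ℝ := (N : ℝ) + 1 with hM
  have hM0 : 0 < M := by positivity
  set L := Real.log δ⁻¹ with hL
  obtain ⟨θ, s, hθ0, hs0, hsθ, hsL⟩ := exists_chernoff_parameter hν0 hC0 ht hx0 htL
  rw [hxk] at hsL
  have hνε : 0 < 1 - ν * ε :=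
    sub_pos.2 (mul_lt_one_of_nonneg_of_lt_one_left hν0.le (by linarith) hε1.le)
  have hlamx : lam * x + x * ν = x := by rw [hν]; ring
  -- `ys` is the point at which the infidelity bound `(y - k + σ) / (y - k + σ + λ(M - y))` equals
  -- `ε`; `Qs` below is the denominator there.
  obtain ⟨ys, hys⟩ : ∃ ys : ℝ, (1 - ν * ε) * ys = (1 - ε) * (k - σ) + ε * lam * M :=
    ⟨((1 - ε) * (k - σ) + ε * lam * M) / (1 - ν * ε), by field_simp⟩
  have hysm : x + t + 1 ≤ ys := by
    refine le_of_mul_le_mul_left ?_ hνε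
    rw [hys, ← hxk]
    have q1 : 0 ≤ ν * ε * (t + 1) := by positivity
    have q2 : 0 ≤ ε * σ := by positivity
    linear_combination hN + q1 + q2 - hlamx
  have hQs : 0 < σ - k + ν * ys + lam * M := by
    have : ν * x ≤ ν * ys := by gcongr; linarith
    have : 0 < lam * M := by positivity
    linarith
  set Qs := σ - k + ν * ys + lam * M with hQsdef
  have hxM : x + 1 ≤ M := by
    have q1 : ε * lam * M ≤ lam * M :=
      mul_le_mul_of_nonneg_right (mul_le_of_le_one_left h0.le hε1.le) hM0.le
    have q2 : lam * (x + 1) ≤ lam * M := by linarith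
    exact le_of_mul_le_mul_left q2 h0
  refine ⟨(1 - ν * ε) / Qs / s, by positivity, fun j hj => ?_⟩
  have hj' : (j : ℝ) ≤ M := by rw [hM]; exact_mod_cast hj
  have he0 := badWeight_nonneg h0 h1.le k N j
  have hg0 := goodWeight_nonneg h0 h1.le (k := k) hj
  have hhF := badWeight_add_goodWeight_le h0 h1.le (k := k) hj
  have hh0 := (failCDF_pos h0 h1.le j k).trans_le
    (failCDF_le_badWeight_add_goodWeight h0 h1.le k N j)
  -- For small `j` the conditional mean is only bounded by its value at the threshold, so the
  -- infidelity bound is frozen at `x + 1`.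
  set y := max (j : ℝ) (x + 1) with hy
  have hyj : (j : ℝ) ≤ y := le_max_left _ _
  have hyx : x + 1 ≤ y := le_max_right _ _
  have hyM : y ≤ M := max_le hj' hxM
  have hνy : (k : ℝ) + ν ≤ ν * y := by
    have := mul_le_mul_of_nonneg_left hyx hν0.le
    rwa [mul_add, mul_one, hxk] at this
  have hA0 : 0 ≤ y - k + σ := by
    have := mul_le_of_le_one_left hx0 (by linarith : ν ≤ 1)
    linarith
  -- the conditional infidelity for `j` orthogonal systems
  have claim1 : badWeight lam k N j * (y - k + σ + lam * (M - y))
      ≤ (y - k + σ) * (badWeight lam k N j + goodWeight lam k N j) := by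
    suffices h : badWeight lam k N j * (lam * (M - y)) ≤ (y - k + σ) * goodWeight lam k N j by
      linarith
    cases j with
    | zero => simp only [badWeight, Nat.cast_zero, zero_mul, zero_div]; positivity
    | succ m =>
      have hA : lam * (m + 1) * failCDF lam m k ≤ (y - k + σ) * failCDF lam (m + 1) k := by
        rcases le_or_gt (m : ℝ) x with hmx | hmx
        · refine (mul_failCDF_le_of_ge h0 h1 (by rw [hxdef]; exact hmx)).trans ?_
          rw [hxdef]
          exact mul_le_mul_of_nonneg_right (by linarith) (failCDF_pos h0 h1.le _ _).le
        · have hk : (k : ℝ) ≤ (1 - lam) * (m + 1) := by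
            rw [← hν, ← hxk]; exact mul_le_mul_of_nonneg_left (by linarith) hν0.le
          refine (mul_failCDF_le_of_le h0 h1.le hk).trans ?_
          refine mul_le_mul_of_nonneg_right ?_ (failCDF_pos h0 h1.le _ _).le
          push_cast at hyj; linarith
      unfold badWeight goodWeight
      rw [← hM, Nat.add_sub_cancel]
      rw [div_mul_eq_mul_div, ← mul_div_assoc]
      refine div_le_div_of_nonneg_right ?_ hM0.le
      have hF := failCDF_pos h0 h1.le (m + 1) k
      push_cast at hyj hj' ⊢
      calc ((m : ℝ) + 1) * failCDF lam m k * (lam * (M - y))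
          = (lam * (m + 1) * failCDF lam m k) * (M - y) := by ring
        _ ≤ ((y - k + σ) * failCDF lam (m + 1) k) * (M - (m + 1)) := by
            refine mul_le_mul hA (by linarith) (by linarith) (by positivity)
        _ = _ := by ring
  set e := badWeight lam k N j with he
  set h := e + goodWeight lam k N j with hh
  have hQ : y - k + σ + lam * (M - y) = Qs + ν * (y - ys) := by rw [hQsdef, hν]; ring
  have hQ0 : 0 < Qs + ν * (y - ys) := by
    have : 0 < lam * M := by positivity
    rw [hQsdef, mul_sub]; linarith
  have hD : y - k + σ = ε * (Qs + ν * (y - ys)) + (1 - ν * ε) * (y - ys) := by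
    rw [← hQ]; rw [mul_sub (1 - ν * ε), hys, hν]; ring
  -- The function `(y - ys) / (Qs + ν(y - ys))` is concave, hence lies below its tangent at `ys`;
  -- the discarded term is the square in `c2`.
  have claim2 : e - ε * h ≤ (1 - ν * ε) / Qs * (y - ys) * h := by
    rw [hQ] at claim1
    rw [hD] at claim1
    have c1 : (e - ε * h) * (Qs + ν * (y - ys)) ≤ (1 - ν * ε) * (y - ys) * h := by linarith
    have c2 : (1 - ν * ε) * (y - ys) * h
        ≤ (1 - ν * ε) / Qs * (y - ys) * h * (Qs + ν * (y - ys)) := by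
      have : (1 - ν * ε) / Qs * (y - ys) * h * (Qs + ν * (y - ys))
          = (1 - ν * ε) * (y - ys) * h + (1 - ν * ε) / Qs * h * ν * (y - ys) ^ 2 := by
        field_simp
      rw [this]
      have : 0 ≤ (1 - ν * ε) / Qs * h * ν * (y - ys) ^ 2 := by positivity
      linarith
    exact le_of_mul_le_mul_right (c1.trans c2) hQ0
  have hδL : Real.exp (-L) = δ := by rw [hL, Real.log_inv, neg_neg, Real.exp_log hδ0]
  -- For `j ≥ x + 1` this is Chernoff's bound for `j - 1` tests. For smaller `j`, `h ≤ 1` suffices: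
  -- `s ≤ νθ` gives `s x ≤ θ k`, hence `s t ≥ L`.
  have claim3 : h * Real.exp (s * (y - 1 - (x + t))) ≤ δ := by
    rcases le_total (j : ℝ) (x + 1) with hjx | hjx
    · have hyeq : y = x + 1 := max_eq_right hjx
      have hle : s * (y - 1 - (x + t)) ≤ -L := by
        have : s * x ≤ θ * k := by
          rw [← hxk, ← mul_assoc]
          refine mul_le_mul_of_nonneg_right ?_ hx0
          rw [hsθ]; have : 0 ≤ C * θ ^ 2 / 2 := by positivity
          linarith
        rw [hyeq]; linarith
      calc h * Real.exp (s * (y - 1 - (x + t)))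
          ≤ 1 * Real.exp (-L) :=
            mul_le_mul (hhF.trans (failCDF_le_one h0.le h1.le _ _)) (Real.exp_le_exp.2 hle)
              (Real.exp_pos _).le zero_le_one
        _ = δ := by rw [one_mul, hδL]
    · have hyeq : y = j := max_eq_left hjx
      have hj1 : 1 ≤ j := by
        rcases Nat.eq_zero_or_pos j with rfl | h
        · simp at hjx; linarith
        · exact h
      have hc := failCDF_le_exp h0 h1.le hθ0.le hC (j - 1) k
      rw [← hν, ← hsθ, Nat.cast_sub hj1, Nat.cast_one] at hc
      calc h * Real.exp (s * (y - 1 - (x + t)))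
          ≤ Real.exp (θ * k - s * (j - 1)) * Real.exp (s * (y - 1 - (x + t))) := by
            gcongr; exact hhF.trans hc
        _ = Real.exp (θ * k - s * (x + t)) := by rw [← Real.exp_add, hyeq]; congr 1; ring
        _ ≤ Real.exp (-L) := Real.exp_le_exp.2 (by linarith)
        _ = δ := hδL
  have claim4 : s * (y - 1 - (x + t)) * h ≤ δ - h := by
    have := mul_le_mul_of_nonneg_left (Real.add_one_le_exp (s * (y - 1 - (x + t)))) hh0.le
    linarith
  calc e - ε * h ≤ (1 - ν * ε) / Qs * (y - ys) * h := claim2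
    _ ≤ (1 - ν * ε) / Qs * (y - 1 - (x + t)) * h := by gcongr ?_ * ?_ * h; linarith
    _ = (1 - ν * ε) / Qs / s * (s * (y - 1 - (x + t)) * h) := by field_simp
    _ ≤ (1 - ν * ε) / Qs / s * (δ - h) := by gcongr

/-! ### The median of a binomial variable with integer mean. -/

lemma failCDF_eq_one {lam : ℝ} {m k : ℕ} (h : m ≤ k) : failCDF lam m k = 1 := by
  induction m with
  | zero => exact failCDF_zero lam k
  | succ m ih =>
    rw [failCDF_succ, ih (by omega)]
    simp [failPMF, Nat.choose_eq_zero_of_lt (by omega : m < k)]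

/-- The derivative of the acceptance probability with respect to the failure rate. -/
lemma hasDerivAt_failCDF (n k : ℕ) (p : ℝ) :
    HasDerivAt (fun p => failCDF (1 - p) (n + 1) k) (-((n + 1) * failPMF (1 - p) n k)) p := by
  have e : ∀ (m i : ℕ) (p : ℝ), failPMF (1 - p) m i = (bernsteinPolynomial ℝ m i).eval p :=
    fun m i p => by simp [failPMF, bernsteinPolynomial]
  have hd : ∀ i : ℕ, HasDerivAt (fun p => failPMF (1 - p) (n + 1) i)
      ((Polynomial.derivative (bernsteinPolynomial ℝ (n + 1) i)).eval p) p := fun i => by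
    simp_rw [e]; exact Polynomial.hasDerivAt _ _
  induction k with
  | zero =>
    have := hd 0
    rw [bernsteinPolynomial.derivative_zero] at this
    simp only [failCDF, zero_add, Finset.sum_range_one]
    refine this.congr_deriv ?_
    simp [e]
    ring
  | succ k ih =>
    have e2 : (fun p => failCDF (1 - p) (n + 1) (k + 1))
        = fun p => failCDF (1 - p) (n + 1) k + failPMF (1 - p) (n + 1) (k + 1) := by
      funext p; unfold failCDF; rw [Finset.sum_range_succ]
    rw [e2]
    refine (ih.add (hd (k + 1))).congr_deriv ?_
    rw [bernsteinPolynomial.derivative_succ]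
    simp [e]
    ring

lemma antitoneOn_failCDF (n k : ℕ) :
    AntitoneOn (fun p => failCDF (1 - p) (n + 1) k) (Set.Icc 0 1) := by
  refine antitoneOn_of_deriv_nonpos (convex_Icc 0 1)
    (fun x _ => (hasDerivAt_failCDF n k x).continuousAt.continuousWithinAt)
    (fun x _ => (hasDerivAt_failCDF n k x).differentiableAt.differentiableWithinAt) fun x hx => ?_
  rw [interior_Icc] at hx
  rw [(hasDerivAt_failCDF n k x).deriv, neg_nonpos]
  exact mul_nonneg (by positivity) (failPMF_nonneg (by linarith [hx.2]) (by linarith [hx.1]) _ _)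

/-- Around an integer mean, the density of the Beta distribution is skewed to the right. -/
lemma pow_mul_pow_le_of_mean {p u : ℝ} {n k : ℕ} (hk : (k : ℝ) = (n + 1) * p) (hkn : k ≤ n)
    (hp : p ≤ 1 / 2) (hu0 : 0 ≤ u) (hup : u < p) :
    (p - u) ^ k * (1 - p + u) ^ (n - k) ≤ (p + u) ^ k * (1 - p - u) ^ (n - k) := by
  have hm : ((n - k : ℕ) : ℝ) = (n + 1) * (1 - p) - 1 := by
    rw [Nat.cast_sub hkn, hk]; ring
  set q := 1 - p with hq
  set H : ℝ → ℝ := fun u => k * (Real.log (p + u) - Real.log (p - u))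
    - (n - k : ℕ) * (Real.log (q + u) - Real.log (q - u)) with hH
  have hHd : ∀ x, 0 ≤ x → x < p → HasDerivAt H (k * (1 / (p + x) - -1 / (p - x))
      - (n - k : ℕ) * (1 / (q + x) - -1 / (q - x))) x := fun x h0 h1 => by
    have l1 : ∀ a : ℝ, a + x ≠ 0 → HasDerivAt (fun x => Real.log (a + x)) (1 / (a + x)) x :=
      fun a ha => ((hasDerivAt_id x).const_add a).log ha
    have l2 : ∀ a : ℝ, a - x ≠ 0 → HasDerivAt (fun x => Real.log (a - x)) (-1 / (a - x)) x :=
      fun a ha => ((hasDerivAt_id x).const_sub a).log ha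
    exact (((l1 p (by linarith)).sub (l2 p (by linarith))).const_mul _).sub
      (((l1 q (by linarith)).sub (l2 q (by linarith))).const_mul _)
  have hmono : MonotoneOn H (Set.Ico 0 p) := by
    refine monotoneOn_of_deriv_nonneg (convex_Ico 0 p)
      (fun x hx => (hHd x hx.1 hx.2).continuousAt.continuousWithinAt)
      (fun x hx => ?_) fun x hx => ?_
    · rw [interior_Ico] at hx
      exact (hHd x hx.1.le hx.2).differentiableAt.differentiableWithinAt
    · rw [interior_Ico] at hx
      obtain ⟨h0, h1⟩ := hx
      rw [(hHd x h0.le h1).deriv, hm, hk]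
      have hpx : 0 < p - x := by linarith
      have hqx : 0 < q - x := by linarith
      have hpx' : 0 < p + x := by linarith
      have hqx' : 0 < q + x := by linarith
      -- Both summands on the right are nonnegative: the first because `p ≤ q`, the second from the
      -- `-1` in `n - k = (n + 1) q - 1`.
      have e : ((n : ℝ) + 1) * p * (1 / (p + x) - -1 / (p - x))
            - ((n + 1) * q - 1) * (1 / (q + x) - -1 / (q - x))
          = 2 * (n + 1) * x ^ 2 * (q ^ 2 - p ^ 2) / ((p - x) * (p + x) * ((q - x) * (q + x)))
            + 2 * q / ((q - x) * (q + x)) := by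
        field_simp; ring
      rw [e]
      have : 0 ≤ q ^ 2 - p ^ 2 := by nlinarith
      have : 0 ≤ q := by linarith
      positivity
  have h := hmono (Set.mem_Ico.2 ⟨le_rfl, by linarith⟩) (Set.mem_Ico.2 ⟨hu0, hup⟩) hu0
  simp only [hH, add_zero, sub_zero, sub_self, mul_zero] at h
  have hpu : 0 < p - u := by linarith
  have hqu : 0 < q - u := by linarith
  have hpu' : 0 < p + u := by linarith
  have hqu' : 0 < q + u := by linarith
  rw [← Real.log_le_log_iff (by positivity) (by positivity),
    Real.log_mul (by positivity) (by positivity), Real.log_mul (by positivity) (by positivity),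
    Real.log_pow, Real.log_pow, Real.log_pow, Real.log_pow]
  linarith

/-- The skewness inequality makes `G (p - u) + G (p + u)` decrease in `u`; comparing `u = 0` with `u
= p` gives `2 G p ≥ G 0 + G (2p) ≥ 1`. The assumption `p ≤ 1/2` also keeps `2p` a probability. -/
lemma half_le_failCDF_of_mean_of_le {p : ℝ} {n k : ℕ} (hk : (k : ℝ) = (n + 1) * p) (hkn : k ≤ n)
    (hp0 : 0 ≤ p) (hp : p ≤ 1 / 2) : 1 / 2 ≤ failCDF (1 - p) (n + 1) k := by
  set G : ℝ → ℝ := fun p => failCDF (1 - p) (n + 1) k with hG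
  set D : ℝ → ℝ := fun u => G (p - u) + G (p + u) with hD
  have hDd : ∀ u, HasDerivAt D ((n + 1) * failPMF (1 - (p - u)) n k
      - (n + 1) * failPMF (1 - (p + u)) n k) u := fun u => by
    have h1 := (hasDerivAt_failCDF n k (p - u)).comp u ((hasDerivAt_id u).const_sub p)
    have h2 := (hasDerivAt_failCDF n k (p + u)).comp u ((hasDerivAt_id u).const_add p)
    exact (h1.add h2).congr_deriv (by ring)
  have hanti : AntitoneOn D (Set.Icc 0 p) := by
    refine antitoneOn_of_deriv_nonpos (convex_Icc 0 p)
      (fun x _ => (hDd x).continuousAt.continuousWithinAt)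
      (fun x _ => (hDd x).differentiableAt.differentiableWithinAt) fun u hu => ?_
    rw [interior_Icc] at hu
    have h := pow_mul_pow_le_of_mean hk hkn hp hu.1.le hu.2
    rw [(hDd u).deriv, ← mul_sub]
    refine mul_nonpos_of_nonneg_of_nonpos (by positivity) (sub_nonpos.2 ?_)
    unfold failPMF
    rw [mul_assoc, mul_assoc]
    refine mul_le_mul_of_nonneg_left ?_ (by positivity)
    rwa [sub_sub_cancel, sub_sub_cancel, ← sub_add, ← sub_sub]
  have h := hanti (Set.mem_Icc.2 ⟨le_rfl, hp0⟩) (Set.mem_Icc.2 ⟨hp0, le_rfl⟩) hp0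
  have h0 : G 0 = 1 := by
    simp only [hG, failCDF, failPMF]
    rw [Finset.sum_range_succ', Finset.sum_eq_zero]
    · simp
    · intro i _; simp
  have h2 : 0 ≤ G (p + p) :=
    Finset.sum_nonneg fun i _ => failPMF_nonneg (by linarith) (by linarith) _ _
  simp only [hD, sub_self, sub_zero, add_zero, h0] at h
  change 1 / 2 ≤ G p
  linarith

/-- Reflecting the upper tail about `k + 1/2` dominates it termwise by the lower one, by induction
outward through the ratios of consecutive terms. -/
lemma failPMF_le_reflect {lam : ℝ} {N k : ℕ} (h0 : 0 < lam) (h1 : lam ≤ 1 / 2)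
    (hk : (k : ℝ) = (1 - lam) * N) {i : ℕ} (hi : i ≤ k) :
    failPMF lam N (k + 1 + i) ≤ failPMF lam N (k - i) := by
  have hnn := fun i => failPMF_nonneg h0.le (by linarith : lam ≤ 1) N i
  have hν : 0 < 1 - lam := by linarith
  induction i with
  | zero =>
    have h := succ_mul_failPMF lam N k
    simp only [add_zero, Nat.sub_zero]
    have e : lam * (((k : ℝ) + 1) * failPMF lam N (k + 1)) = lam * (k * failPMF lam N k) := by
      rw [hk] at h ⊢; linear_combination h
    have e2 := mul_left_cancel₀ h0.ne' e
    have : ((k : ℝ) + 1) * failPMF lam N (k + 1) ≤ (k + 1) * failPMF lam N k := by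
      rw [e2]; linarith [hnn k]
    exact le_of_mul_le_mul_left this (by positivity)
  | succ i ih =>
    have ih := ih (by omega)
    have s1 := succ_mul_failPMF lam N (k + 1 + i)
    have s2 := succ_mul_failPMF lam N (k - (i + 1))
    rw [show k - (i + 1) + 1 = k - i by omega, Nat.cast_sub hi] at s2
    rw [show k + 1 + i + 1 = k + 1 + (i + 1) by ring] at s1
    push_cast at s1 s2
    rcases lt_or_ge N (k + 1 + (i + 1)) with hN | hN
    · have : failPMF lam N (k + 1 + (i + 1)) = 0 := by
        simp [failPMF, Nat.choose_eq_zero_of_lt hN]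
      rw [this]; exact hnn _
    · have hN' : (k : ℝ) + 1 + (i + 1) ≤ N := by exact_mod_cast hN
      have hi' : (i : ℝ) + 1 ≤ k := by exact_mod_cast hi
      have hi0 : (0 : ℝ) ≤ i := by positivity
      set a := failPMF lam N (k + 1 + (i + 1))
      set b := failPMF lam N (k - (i + 1))
      have hb : 0 ≤ b := hnn _
      have c1 : 0 ≤ (N : ℝ) - (k + 1 + i) := by linarith
      have hpos : 0 < (((k : ℝ) + 1 + i + 1) * lam) * ((k - (i + 1) + 1) * lam) := by
        have : 0 < (k : ℝ) - (i + 1) + 1 := by linarith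
        positivity
      have hcoef : (((N : ℝ) - (k + 1 + i)) * (1 - lam)) * ((N - (k - (i + 1))) * (1 - lam))
          ≤ (((k : ℝ) + 1 + i + 1) * lam) * ((k - (i + 1) + 1) * lam) := by
        have hNk : (N : ℝ) = k + lam * N := by rw [hk]; ring
        have e : (((k : ℝ) + 1 + i + 1) * lam) * ((k - (i + 1) + 1) * lam)
            - (((N : ℝ) - (k + 1 + i)) * (1 - lam)) * ((N - (k - (i + 1))) * (1 - lam))
            = lam ^ 2 * (2 * k + 1) + (1 - 2 * lam) * (i + 1) ^ 2 := by
          rw [hk]; ring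
        have : 0 ≤ lam ^ 2 * (2 * (k : ℝ) + 1) + (1 - 2 * lam) * (i + 1) ^ 2 := by
          have : 0 ≤ 1 - 2 * lam := by linarith
          positivity
        linarith
      refine le_of_mul_le_mul_left ?_ hpos
      calc (((k : ℝ) + 1 + i + 1) * lam) * ((k - (i + 1) + 1) * lam) * a
          = (((k : ℝ) + 1 + i + 1) * lam * a) * ((k - (i + 1) + 1) * lam) := by ring
        _ = (((N : ℝ) - (k + 1 + i)) * (1 - lam) * failPMF lam N (k + 1 + i))
              * ((k - (i + 1) + 1) * lam) := by rw [s1]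
        _ ≤ (((N : ℝ) - (k + 1 + i)) * (1 - lam) * failPMF lam N (k - i))
              * ((k - (i + 1) + 1) * lam) := by
            have : 0 ≤ (k : ℝ) - (i + 1) + 1 := by linarith
            gcongr
        _ = (((N : ℝ) - (k + 1 + i)) * (1 - lam))
              * ((k - (i + 1) + 1) * lam * failPMF lam N (k - i)) := by ring
        _ = (((N : ℝ) - (k + 1 + i)) * (1 - lam)) * ((N - (k - (i + 1))) * (1 - lam)) * b := by
            rw [s2]; ring
        _ ≤ _ := mul_le_mul_of_nonneg_right hcoef hb

lemma half_le_failCDF_of_mean_of_ge {lam : ℝ} {N k : ℕ} (h0 : 0 < lam) (h1 : lam ≤ 1 / 2)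
    (hk : (k : ℝ) = (1 - lam) * N) : 1 / 2 ≤ failCDF lam N k := by
  have hkN : k ≤ N := by
    have : (k : ℝ) ≤ N := by rw [hk]; nlinarith [Nat.cast_nonneg (α := ℝ) N]
    exact_mod_cast this
  have hNk : N - k ≤ k + 1 := by
    have : (N : ℝ) ≤ 2 * k := by rw [hk]; nlinarith [Nat.cast_nonneg (α := ℝ) N]
    have : N ≤ 2 * k := by exact_mod_cast this
    omega
  have htot : failCDF lam N N = 1 := failCDF_eq_one le_rfl
  unfold failCDF at htot ⊢
  rw [show N + 1 = (k + 1) + (N - k) by omega, Finset.sum_range_add] at htot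
  have hle : ∑ i ∈ Finset.range (N - k), failPMF lam N (k + 1 + i)
      ≤ ∑ i ∈ Finset.range (k + 1), failPMF lam N i := by
    calc ∑ i ∈ Finset.range (N - k), failPMF lam N (k + 1 + i)
        ≤ ∑ i ∈ Finset.range (N - k), failPMF lam N (k - i) :=
          Finset.sum_le_sum fun i hi => failPMF_le_reflect h0 h1 hk
            (by have := Finset.mem_range.1 hi; omega)
      _ ≤ ∑ i ∈ Finset.range (k + 1), failPMF lam N (k - i) :=
          Finset.sum_le_sum_of_subset_of_nonneg (Finset.range_subset_range.2 hNk)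
            fun i _ _ => failPMF_nonneg h0.le (by linarith) _ _
      _ = _ := by
          rw [← Finset.sum_range_reflect]
          refine Finset.sum_congr rfl fun i hi => ?_
          have := Finset.mem_range.1 hi
          rw [show k - (k + 1 - 1 - i) = i by omega]
  linarith

/-- A binomial variable of mean at most the integer `k` is at most `k` with probability at least
one half. -/
lemma half_le_failCDF {p : ℝ} {N k : ℕ} (hkN : k < N) (hp0 : 0 ≤ p) (hp : p * N ≤ k) :
    1 / 2 ≤ failCDF (1 - p) N k := by
  obtain ⟨n, rfl⟩ : ∃ n, N = n + 1 := ⟨N - 1, by omega⟩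
  have hn : (0 : ℝ) < ((n + 1 : ℕ) : ℝ) := by positivity
  have hkN' : (k : ℝ) < ((n + 1 : ℕ) : ℝ) := by exact_mod_cast hkN
  set r : ℝ := k / ((n + 1 : ℕ) : ℝ) with hr
  have hr1 : r < 1 := by rw [hr, div_lt_one hn]; exact hkN'
  have hpr : p ≤ r := by rw [hr, le_div_iff₀ hn]; exact hp
  have hr0 : 0 ≤ r := hp0.trans hpr
  have hkr : (k : ℝ) = ((n + 1 : ℕ) : ℝ) * r := by rw [hr]; field_simp
  -- Raising the failure rate to `r = k / N` only lowers the tail, so the mean may be taken equal to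
  -- `k`.
  refine le_trans ?_ (antitoneOn_failCDF n k ⟨hp0, hpr.trans hr1.le⟩ ⟨hr0, hr1.le⟩ hpr)
  rcases le_total r (1 / 2) with h | h
  · exact half_le_failCDF_of_mean_of_le (by push_cast at hkr; exact hkr) (by omega) hr0 h
  · exact half_le_failCDF_of_mean_of_ge (by linarith) (by linarith) (by rw [hkr]; ring)

/-! ### Product operators, their traces and permutations of the factors. -/

section tensor

variable {ι : Type*} {n : ℕ}

lemma tensorOp_mul [Fintype ι] (A B : Fin n → Matrix ι ι ℂ) :
    tensorOp A * tensorOp B = tensorOp fun j => A j * B j := by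
  ext x y
  simp only [tensorOp, Matrix.mul_apply, Matrix.of_apply, ← Finset.prod_mul_distrib]
  rw [Finset.prod_univ_sum, Fintype.piFinset_univ]

lemma trace_tensorOp [Fintype ι] (A : Fin n → Matrix ι ι ℂ) :
    (tensorOp A).trace = ∏ j, (A j).trace := by
  simp only [tensorOp, Matrix.trace, Matrix.diag, Matrix.of_apply]
  rw [Finset.prod_univ_sum, Fintype.piFinset_univ]

lemma conjTranspose_tensorOp (A : Fin n → Matrix ι ι ℂ) :
    (tensorOp A).conjTranspose = tensorOp fun j => (A j).conjTranspose := by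
  ext x y
  simp [tensorOp, Matrix.conjTranspose_apply]

lemma tensorOp_one [DecidableEq ι] : tensorOp (fun _ : Fin n => (1 : Matrix ι ι ℂ)) = 1 := by
  ext x y
  simp only [tensorOp, Matrix.of_apply, Matrix.one_apply]
  rw [Finset.prod_ite_zero]
  simp [funext_iff]

lemma tensorOp_add (A B : Fin n → Matrix ι ι ℂ) :
    tensorOp (fun j => A j + B j)
      = ∑ S : Finset (Fin n), tensorOp fun j => if j ∈ S then B j else A j := by
  ext x y
  simp only [tensorOp, Matrix.of_apply, Matrix.sum_apply, Matrix.add_apply]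
  simp_rw [add_comm (A _ _ _)]
  rw [Finset.prod_add, Finset.powerset_univ]
  refine Finset.sum_congr rfl fun S _ => ?_
  rw [← Finset.prod_mul_prod_compl S, ← Finset.compl_eq_univ_sdiff]
  congr 1
  · exact Finset.prod_congr rfl fun j hj => by rw [if_pos hj]
  · exact Finset.prod_congr rfl fun j hj => by rw [if_neg (Finset.mem_compl.1 hj)]

lemma tensorOp_smul (a : Fin n → ℂ) (A : Fin n → Matrix ι ι ℂ) :
    tensorOp (fun j => a j • A j) = (∏ j, a j) • tensorOp A := by
  ext x y
  simp [tensorOp, Finset.prod_mul_distrib]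

lemma tensorOp_smul_add_smul (a b : Fin n → ℂ) (P Q : Matrix ι ι ℂ) :
    tensorOp (fun j => a j • P + b j • Q)
      = ∑ S : Finset (Fin n), ((∏ j ∈ S, b j) * ∏ j ∈ Sᶜ, a j) •
          tensorOp fun j => if j ∈ S then Q else P := by
  rw [tensorOp_add]
  refine Finset.sum_congr rfl fun S _ => ?_
  have e : (fun j => if j ∈ S then b j • Q else a j • P)
      = fun j => (if j ∈ S then b j else a j) • if j ∈ S then Q else P := by
    funext j; split_ifs <;> rfl
  rw [e, tensorOp_smul, ← Finset.prod_mul_prod_compl S]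
  congr 2
  · exact Finset.prod_congr rfl fun j hj => by rw [if_pos hj]
  · exact Finset.prod_congr rfl fun j hj => by rw [if_neg (Finset.mem_compl.1 hj)]

lemma tensorOp_comp_perm (A : Fin n → Matrix ι ι ℂ) (π : Equiv.Perm (Fin n)) (x y : Fin n → ι) :
    tensorOp A (x ∘ π) (y ∘ π) = tensorOp (A ∘ π.symm) x y := by
  simp only [tensorOp, Matrix.of_apply, Function.comp]
  exact Fintype.prod_equiv π _ _ fun j => by simp

lemma trace_tensorOp_comp_perm_mul [Fintype ι] (A : Fin n → Matrix ι ι ℂ)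
    (π : Equiv.Perm (Fin n)) {ρ : Matrix (Fin n → ι) (Fin n → ι) ℂ}
    (hρ : ∀ x y : Fin n → ι, ρ (x ∘ π) (y ∘ π) = ρ x y) :
    (tensorOp (A ∘ π.symm) * ρ).trace = (tensorOp A * ρ).trace := by
  simp only [Matrix.trace, Matrix.diag, Matrix.mul_apply]
  have key : ∀ F : (Fin n → ι) → ℂ, ∑ x, F (x ∘ π) = ∑ x, F x := fun F =>
    Equiv.sum_comp (π.symm.arrowCongr (Equiv.refl ι)) F
  conv_rhs => rw [← key]
  refine Finset.sum_congr rfl fun x _ => ?_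
  conv_rhs => rw [← key]
  exact Finset.sum_congr rfl fun y _ => by rw [tensorOp_comp_perm, hρ]

lemma posSemidef_tensorOp [Fintype ι] {A : Fin n → Matrix ι ι ℂ}
    (hA : ∀ j, ∃ C : Matrix ι ι ℂ, A j = C.conjTranspose * C) : (tensorOp A).PosSemidef := by
  choose C hC using hA
  have : tensorOp A = (tensorOp C).conjTranspose * tensorOp C := by
    rw [conjTranspose_tensorOp, tensorOp_mul]; congr 1; funext j; exact hC j
  rw [this]
  exact Matrix.posSemidef_conjTranspose_mul_self _

lemma re_trace_tensorOp_mul_nonneg [Fintype ι] {A : Fin n → Matrix ι ι ℂ}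
    (hA : ∀ j, ∃ C : Matrix ι ι ℂ, A j = C.conjTranspose * C)
    {ρ : Matrix (Fin n → ι) (Fin n → ι) ℂ} (hρ : ρ.PosSemidef) :
    0 ≤ (tensorOp A * ρ).trace.re := by
  choose C hC using hA
  have : tensorOp A = (tensorOp C).conjTranspose * tensorOp C := by
    rw [conjTranspose_tensorOp, tensorOp_mul]; congr 1; funext j; exact hC j
  rw [this, Matrix.mul_assoc, Matrix.trace_mul_comm]
  exact (Complex.le_def.1 (hρ.mul_mul_conjTranspose_same (tensorOp C)).trace_nonneg).1

lemma exists_perm_mem_iff {S T : Finset (Fin n)} (h : S.card = T.card) :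
    ∃ π : Equiv.Perm (Fin n), ∀ j, π j ∈ T ↔ j ∈ S := by
  have e : {x // x ∈ S} ≃ {x // x ∈ T} := Finset.equivOfCardEq h
  refine ⟨e.extendSubtype, fun j => ⟨fun hj => ?_, fun hj => e.extendSubtype_mem _ hj⟩⟩
  by_contra hS
  exact e.extendSubtype_not_mem _ hS hj

end tensor

/-! ### The target projector and its complement. -/

section projectors

variable {ι : Type*} [Fintype ι] {Ψ : EuclideanSpace ℂ ι}

lemma sum_star_mul_eq_one (hΨ : ‖Ψ‖ = 1) : ∑ a, star (Ψ a) * Ψ a = 1 := by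
  have h := EuclideanSpace.norm_sq_eq Ψ
  rw [hΨ, one_pow] at h
  have e : ∀ a, star (Ψ a) * Ψ a = ((‖Ψ a‖ ^ 2 : ℝ) : ℂ) := fun a => by
    rw [Complex.star_def, Complex.conj_mul', Complex.ofReal_pow]
  simp_rw [e]
  rw [← Complex.ofReal_sum, ← h, Complex.ofReal_one]

lemma pureProj_mul_self (hΨ : ‖Ψ‖ = 1) : pureProj Ψ * pureProj Ψ = pureProj Ψ := by
  ext a b
  simp only [pureProj, Matrix.mul_apply, Matrix.of_apply]
  calc ∑ c, Ψ a * star (Ψ c) * (Ψ c * star (Ψ b))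
      = (∑ c, star (Ψ c) * Ψ c) * (Ψ a * star (Ψ b)) := by
        rw [Finset.sum_mul]; exact Finset.sum_congr rfl fun c _ => by ring
    _ = _ := by rw [sum_star_mul_eq_one hΨ, one_mul]

lemma trace_pureProj (hΨ : ‖Ψ‖ = 1) : (pureProj Ψ).trace = 1 := by
  rw [← sum_star_mul_eq_one hΨ]
  simp only [pureProj, Matrix.trace, Matrix.diag, Matrix.of_apply]
  exact Finset.sum_congr rfl fun a _ => mul_comm _ _

lemma conjTranspose_pureProj {ι : Type*} (Ψ : EuclideanSpace ℂ ι) :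
    (pureProj Ψ).conjTranspose = pureProj Ψ := by
  ext a b
  simp [pureProj, Matrix.conjTranspose_apply, mul_comm]

variable [DecidableEq ι]

lemma pureProj_mul_compl (hΨ : ‖Ψ‖ = 1) : pureProj Ψ * (1 - pureProj Ψ) = 0 := by
  rw [mul_sub, mul_one, pureProj_mul_self hΨ, sub_self]

lemma compl_mul_pureProj (hΨ : ‖Ψ‖ = 1) : (1 - pureProj Ψ) * pureProj Ψ = 0 := by
  rw [sub_mul, one_mul, pureProj_mul_self hΨ, sub_self]

lemma compl_mul_self (hΨ : ‖Ψ‖ = 1) :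
    (1 - pureProj Ψ) * (1 - pureProj Ψ) = 1 - pureProj Ψ := by
  rw [sub_mul, one_mul, pureProj_mul_compl hΨ, sub_zero]

/-- The maximally mixed state on the orthogonal complement of `Ψ`. -/
noncomputable def complState (Ψ : EuclideanSpace ℂ ι) : Matrix ι ι ℂ :=
  (((Fintype.card ι : ℝ) - 1)⁻¹ : ℝ) • (1 - pureProj Ψ)

lemma card_sub_one_pos {ι : Type*} [Fintype ι] [Nontrivial ι] : (0 : ℝ) < Fintype.card ι - 1 := by
  have : (1 : ℝ) < Fintype.card ι := by exact_mod_cast Fintype.one_lt_card (α := ι)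
  linarith

lemma trace_complState [Nontrivial ι] (hΨ : ‖Ψ‖ = 1) : (complState Ψ).trace = 1 := by
  have h := (card_sub_one_pos (ι := ι)).ne'
  rw [complState, Matrix.trace_smul, Matrix.trace_sub, Matrix.trace_one, trace_pureProj hΨ]
  have e : ((Fintype.card ι : ℂ) - 1) = (((Fintype.card ι : ℝ) - 1 : ℝ) : ℂ) := by push_cast; rfl
  rw [e, Complex.real_smul, ← Complex.ofReal_mul, inv_mul_cancel₀ h, Complex.ofReal_one]

lemma exists_conjTranspose_mul_pureProj (hΨ : ‖Ψ‖ = 1) {c : ℝ} (hc : 0 ≤ c) :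
    ∃ C : Matrix ι ι ℂ, c • pureProj Ψ = C.conjTranspose * C :=
  ⟨Real.sqrt c • pureProj Ψ, by
    rw [Matrix.conjTranspose_smul, conjTranspose_pureProj, star_trivial, smul_mul_smul_comm,
      Real.mul_self_sqrt hc, pureProj_mul_self hΨ]⟩

lemma exists_conjTranspose_mul_compl (hΨ : ‖Ψ‖ = 1) {c : ℝ} (hc : 0 ≤ c) :
    ∃ C : Matrix ι ι ℂ, c • (1 - pureProj Ψ) = C.conjTranspose * C :=
  ⟨Real.sqrt c • (1 - pureProj Ψ), by
    rw [Matrix.conjTranspose_smul, Matrix.conjTranspose_sub, Matrix.conjTranspose_one,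
      conjTranspose_pureProj, star_trivial, smul_mul_smul_comm,
      Real.mul_self_sqrt hc, compl_mul_self hΨ]⟩

end projectors

/-! ### Reduction of permutation-invariant states to classical distributions. -/

section reduction

open Polynomial

/-- The linear functional `X ^ j ↦ τ j` on polynomials. -/
noncomputable def coeffFunctional (τ : ℕ → ℝ) : ℝ[X] →ₗ[ℝ] ℝ :=
  (Polynomial.basisMonomials ℝ).constr ℝ τ

lemma coeffFunctional_X_pow (τ : ℕ → ℝ) (j : ℕ) : coeffFunctional τ (X ^ j) = τ j := by
  have := (Polynomial.basisMonomials ℝ).constr_basis ℝ τ j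
  simp only [Polynomial.coe_basisMonomials, Polynomial.monomial_one_right_eq_X_pow] at this
  exact this

lemma coeffFunctional_C_mul_X_pow (τ : ℕ → ℝ) (c : ℝ) (j : ℕ) :
    coeffFunctional τ (C c * X ^ j) = c * τ j := by
  rw [← Polynomial.smul_eq_C_mul, map_smul, coeffFunctional_X_pow, smul_eq_mul]

variable {ι : Type*} [Fintype ι] {n : ℕ}

/-- The weight of a product operator built from two blocks `P` and `Q`, in a state in which the weight
of a word in `P` and `Q` depends only on the number of letters `Q`. -/
lemma re_trace_tensorOp_mul {P Q : Matrix ι ι ℂ} {ρ : Matrix (Fin n → ι) (Fin n → ι) ℂ}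
    {τ : ℕ → ℝ}
    (hτ : ∀ S : Finset (Fin n), ((tensorOp fun j => if j ∈ S then Q else P) * ρ).trace.re = τ S.card)
    (a b : Fin n → ℝ) :
    ((tensorOp fun j => (a j : ℂ) • P + (b j : ℂ) • Q) * ρ).trace.re
      = coeffFunctional τ (∏ j, (C (b j) * X + C (a j))) := by
  rw [tensorOp_smul_add_smul, Finset.sum_mul, Matrix.trace_sum, Complex.re_sum, Finset.prod_add,
    Finset.powerset_univ, map_sum]
  refine Finset.sum_congr rfl fun S _ => ?_
  rw [Matrix.smul_mul, Matrix.trace_smul, smul_eq_mul, ← Complex.ofReal_prod,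
    ← Complex.ofReal_prod, ← Complex.ofReal_mul, Complex.re_ofReal_mul, hτ,
    Finset.prod_mul_distrib, Finset.prod_const, ← map_prod, ← map_prod,
    ← Finset.compl_eq_univ_sdiff,
    mul_right_comm (C _), ← map_mul, coeffFunctional_C_mul_X_pow]

variable [DecidableEq ι]

/-- In the generating polynomial a passed test contributes `1 + λX`, a failed one `νX`, and the last
system `e₀ + e₁X`, where `X` marks a system in the complement of `Ψ`. The pairs `(e₀, e₁) = (1, 0)`
and `(1, 1)` give `f_k` and `p_k`. -/
lemma re_trace_testOp_mul {Ψ : EuclideanSpace ℂ ι} (lam : ℝ) {N i : ℕ} (hi : i ≤ N)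
    {ρ : Matrix (Fin (N + 1) → ι) (Fin (N + 1) → ι) ℂ} {τ : ℕ → ℝ}
    (hτ : ∀ S : Finset (Fin (N + 1)),
      ((tensorOp fun j => if j ∈ S then 1 - pureProj Ψ else pureProj Ψ) * ρ).trace.re = τ S.card)
    (e₀ e₁ : ℝ) :
    (testOp Ψ lam N i ((e₀ : ℂ) • pureProj Ψ + (e₁ : ℂ) • (1 - pureProj Ψ)) * ρ).trace.re
      = ∑ l ∈ Finset.range (N - i + 1), ((N - i).choose l : ℝ) * lam ^ l * (1 - lam) ^ i
          * (e₀ * τ (l + i) + e₁ * τ (l + i + 1)) := by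
  set a : Fin (N + 1) → ℝ := fun j =>
    if (j : ℕ) < N - i then 1 else if (j : ℕ) < N then 0 else e₀ with ha
  set b : Fin (N + 1) → ℝ := fun j =>
    if (j : ℕ) < N - i then lam else if (j : ℕ) < N then 1 - lam else e₁ with hb
  have e : testOp Ψ lam N i ((e₀ : ℂ) • pureProj Ψ + (e₁ : ℂ) • (1 - pureProj Ψ))
      = tensorOp fun j => (a j : ℂ) • pureProj Ψ + (b j : ℂ) • (1 - pureProj Ψ) := by
    unfold testOp
    congr 1
    funext j
    simp only [ha, hb, strategy]
    split_ifs
    · simp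
    · push_cast; module
    · rfl
  have hprod : ∏ j, (C (b j) * X + C (a j))
      = (C lam * X + C 1) ^ (N - i) * (C (1 - lam) * X) ^ i * (C e₁ * X + C e₀) := by
    rw [Fin.prod_univ_castSucc]
    congr 1
    · have : ∀ j : Fin N, (C (b j.castSucc) * X + C (a j.castSucc) : ℝ[X])
          = (fun m : ℕ => if m < N - i then C lam * X + C 1 else C (1 - lam) * X) (j : ℕ) := by
        intro j
        have hj := j.2
        simp only [ha, hb, Fin.val_castSucc, hj, if_true]
        split_ifs <;> simp
      simp_rw [this]
      rw [Fin.prod_univ_eq_prod_range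
        (fun m : ℕ => if m < N - i then (C lam * X + C 1 : ℝ[X]) else C (1 - lam) * X) N]
      conv_lhs => rw [show N = (N - i) + i by omega]
      rw [Finset.prod_range_add]
      congr 1
      · rw [Finset.prod_congr rfl (g := fun _ => (C lam * X + C 1 : ℝ[X])), Finset.prod_const,
          Finset.card_range]
        intro m hm
        rw [if_pos]
        have := Finset.mem_range.1 hm
        omega
      · rw [Finset.prod_congr rfl (g := fun _ => (C (1 - lam) * X : ℝ[X])), Finset.prod_const,
          Finset.card_range]
        intro m hm
        rw [if_neg]
        omega
    · have : ¬N < N - i := by omega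
      simp [ha, hb, this]
  rw [e, re_trace_tensorOp_mul hτ, hprod, add_pow, Finset.sum_mul, Finset.sum_mul, map_sum]
  refine Finset.sum_congr rfl fun l _ => ?_
  have : (C lam * X) ^ l * C 1 ^ (N - i - l) * ((N - i).choose l : ℝ[X]) * (C (1 - lam) * X) ^ i
        * (C e₁ * X + C e₀)
      = C (((N - i).choose l : ℝ) * lam ^ l * (1 - lam) ^ i * e₀) * X ^ (l + i)
        + C (((N - i).choose l : ℝ) * lam ^ l * (1 - lam) ^ i * e₁) * X ^ (l + i + 1) := by
    simp only [map_mul, map_pow, map_natCast, map_one, one_pow]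
    ring
  rw [this, map_add, coeffFunctional_C_mul_X_pow, coeffFunctional_C_mul_X_pow]
  ring

lemma sum_choose_mul_failPMF (lam : ℝ) {N i : ℕ} (hi : i ≤ N) (w : ℕ → ℝ) :
    (N.choose i : ℝ) * ∑ l ∈ Finset.range (N - i + 1),
        ((N - i).choose l : ℝ) * lam ^ l * (1 - lam) ^ i * w (l + i)
      = ∑ m ∈ Finset.range (N + 1), (N.choose m : ℝ) * failPMF lam m i * w m := by
  have hlow : ∑ m ∈ Finset.range i, (N.choose m : ℝ) * failPMF lam m i * w m = 0 :=
    Finset.sum_eq_zero fun m hm => by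
      simp [failPMF, Nat.choose_eq_zero_of_lt (Finset.mem_range.1 hm)]
  rw [show N + 1 = i + (N - i + 1) by omega, Finset.sum_range_add _ i, hlow, zero_add,
    Finset.mul_sum]
  refine Finset.sum_congr rfl fun l hl => ?_
  have := Nat.choose_mul (n := N) (Nat.le_add_right i l)
  rw [Nat.add_sub_cancel_left] at this
  have : (N.choose (i + l) : ℝ) * ((i + l).choose i) = N.choose i * (N - i).choose l := by
    exact_mod_cast this
  unfold failPMF
  rw [Nat.add_sub_cancel_left, add_comm l i]
  linear_combination -(lam ^ l * (1 - lam) ^ i * w (i + l)) * this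

lemma sum_choose_mul_re_trace_testOp {Ψ : EuclideanSpace ℂ ι} (lam : ℝ) {N k : ℕ} (hk : k ≤ N)
    {ρ : Matrix (Fin (N + 1) → ι) (Fin (N + 1) → ι) ℂ} {τ : ℕ → ℝ}
    (hτ : ∀ S : Finset (Fin (N + 1)),
      ((tensorOp fun j => if j ∈ S then 1 - pureProj Ψ else pureProj Ψ) * ρ).trace.re = τ S.card)
    (e₀ e₁ : ℝ) :
    ∑ i ∈ Finset.range (k + 1), (N.choose i : ℝ) *
        (testOp Ψ lam N i ((e₀ : ℂ) • pureProj Ψ + (e₁ : ℂ) • (1 - pureProj Ψ)) * ρ).trace.re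
      = ∑ m ∈ Finset.range (N + 1), (N.choose m : ℝ) * failCDF lam m k
          * (e₀ * τ m + e₁ * τ (m + 1)) := by
  have : ∀ i ∈ Finset.range (k + 1), (N.choose i : ℝ) *
        (testOp Ψ lam N i ((e₀ : ℂ) • pureProj Ψ + (e₁ : ℂ) • (1 - pureProj Ψ)) * ρ).trace.re
      = ∑ m ∈ Finset.range (N + 1), (N.choose m : ℝ) * failPMF lam m i
          * (e₀ * τ m + e₁ * τ (m + 1)) := fun i hi => by
    have hi' : i ≤ N := by have := Finset.mem_range.1 hi; omega
    rw [re_trace_testOp_mul lam hi' hτ,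
      sum_choose_mul_failPMF lam hi' fun m => e₀ * τ m + e₁ * τ (m + 1)]
  rw [Finset.sum_congr rfl this, Finset.sum_comm]
  refine Finset.sum_congr rfl fun m _ => ?_
  rw [failCDF, Finset.mul_sum, Finset.sum_mul]

/-- The acceptance probabilities in terms of the distribution of the number of systems orthogonal
to the target. -/
lemma acceptProb_eq_sum {Ψ : EuclideanSpace ℂ ι} (lam : ℝ) {N k : ℕ} (hk : k ≤ N)
    {ρ : Matrix (Fin (N + 1) → ι) (Fin (N + 1) → ι) ℂ} {τ c : ℕ → ℝ}
    (hτ : ∀ S : Finset (Fin (N + 1)),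
      ((tensorOp fun j => if j ∈ S then 1 - pureProj Ψ else pureProj Ψ) * ρ).trace.re = τ S.card)
    (hc : ∀ j ∈ Finset.range (N + 2), c j = ((N + 1).choose j : ℝ) * τ j) :
    acceptTargetProb Ψ lam k N ρ = ∑ j ∈ Finset.range (N + 2), c j * goodWeight lam k N j ∧
    acceptProb Ψ lam k N ρ = ∑ j ∈ Finset.range (N + 2),
      c j * (badWeight lam k N j + goodWeight lam k N j) := by
  have hN : ((N : ℝ) + 1) ≠ 0 := by positivity
  have hgood : ∑ j ∈ Finset.range (N + 2), c j * goodWeight lam k N j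
      = ∑ m ∈ Finset.range (N + 1), (N.choose m : ℝ) * failCDF lam m k * τ m := by
    rw [Finset.sum_range_succ]
    have : goodWeight lam k N (N + 1) = 0 := by simp [goodWeight]
    rw [this, mul_zero, add_zero]
    refine Finset.sum_congr rfl fun j hj => ?_
    have hj' := Finset.mem_range.1 hj
    rw [hc j (Finset.mem_range.2 (by omega)), goodWeight]
    have e : ((N.choose j : ℕ) : ℝ) * (N + 1) = ((N + 1).choose j : ℝ) * ((N : ℝ) + 1 - j) := by
      have := Nat.choose_mul_succ_eq N j
      have h3 : ((N + 1 - j : ℕ) : ℝ) = (N : ℝ) + 1 - j := by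
        rw [Nat.cast_sub hj'.le]; push_cast; ring
      rw [← h3]; exact_mod_cast this
    field_simp
    linear_combination (-τ j * failCDF lam j k) * e
  have hbad : ∑ j ∈ Finset.range (N + 2), c j * badWeight lam k N j
      = ∑ m ∈ Finset.range (N + 1), (N.choose m : ℝ) * failCDF lam m k * τ (m + 1) := by
    rw [Finset.sum_range_succ']
    have : badWeight lam k N 0 = 0 := by simp [badWeight]
    rw [this, mul_zero, add_zero]
    refine Finset.sum_congr rfl fun j hj => ?_
    have hj' := Finset.mem_range.1 hj
    rw [hc (j + 1) (Finset.mem_range.2 (by omega)), badWeight, Nat.add_sub_cancel]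
    have e : ((N : ℝ) + 1) * N.choose j = ((N + 1).choose (j + 1) : ℝ) * (j + 1) := by
      exact_mod_cast Nat.add_one_mul_choose_eq N j
    push_cast
    field_simp
    linear_combination (-τ (j + 1) * failCDF lam j k) * e
  constructor
  · have h := sum_choose_mul_re_trace_testOp lam hk hτ 1 0
    simp only [Complex.ofReal_one, Complex.ofReal_zero, one_smul, zero_smul, add_zero, one_mul,
      zero_mul] at h
    rw [hgood, ← h, acceptTargetProb]
  · have h := sum_choose_mul_re_trace_testOp lam hk hτ 1 1
    simp only [Complex.ofReal_one, one_smul, add_sub_cancel, one_mul] at h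
    simp_rw [mul_add]
    rw [Finset.sum_add_distrib, hgood, hbad, acceptProb, h, ← Finset.sum_add_distrib]
    exact Finset.sum_congr rfl fun m _ => by ring

/-- The law is `c j = choose (N + 1) j * τ j`, where `τ j` is the weight of any one pattern with `j`
orthogonal systems. Permutation invariance makes this weight independent of the pattern. -/
lemma exists_distribution {Ψ : EuclideanSpace ℂ ι} (hΨ : ‖Ψ‖ = 1) (lam : ℝ) {N k : ℕ} (hk : k ≤ N)
    {ρ : Matrix (Fin (N + 1) → ι) (Fin (N + 1) → ι) ℂ} (hρ : IsPermInvState ρ) :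
    ∃ c : ℕ → ℝ, (∀ j, 0 ≤ c j) ∧ ∑ j ∈ Finset.range (N + 2), c j = 1 ∧
      acceptTargetProb Ψ lam k N ρ = ∑ j ∈ Finset.range (N + 2), c j * goodWeight lam k N j ∧
      acceptProb Ψ lam k N ρ = ∑ j ∈ Finset.range (N + 2),
        c j * (badWeight lam k N j + goodWeight lam k N j) := by
  set R : Finset (Fin (N + 1)) → Matrix (Fin (N + 1) → ι) (Fin (N + 1) → ι) ℂ :=
    fun S => tensorOp fun j => if j ∈ S then 1 - pureProj Ψ else pureProj Ψ with hR
  have hnn : ∀ S, 0 ≤ (R S * ρ).trace.re := fun S => by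
    refine re_trace_tensorOp_mul_nonneg (fun j => ?_) hρ.posSemidef
    split_ifs
    · simpa using exists_conjTranspose_mul_compl hΨ zero_le_one
    · simpa using exists_conjTranspose_mul_pureProj hΨ zero_le_one
  set τ : ℕ → ℝ := fun m => (R (Finset.univ.filter fun j : Fin (N + 1) => (j : ℕ) < m) * ρ).trace.re
    with hτdef
  have hτ : ∀ S : Finset (Fin (N + 1)), (R S * ρ).trace.re = τ S.card := fun S => by
    have hcard : S.card = (Finset.univ.filter fun j : Fin (N + 1) => (j : ℕ) < S.card).card := by
      have h1 : S.card ≤ N + 1 := by simpa using S.card_le_univ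
      rw [Fin.card_filter_val_lt, min_eq_right h1]
    obtain ⟨π, hπ⟩ := exists_perm_mem_iff hcard.symm
    have h := trace_tensorOp_comp_perm_mul
      (fun j => if j ∈ Finset.univ.filter (fun j : Fin (N + 1) => (j : ℕ) < S.card)
        then 1 - pureProj Ψ else pureProj Ψ) π (hρ.perm_inv π)
    rw [hτdef]
    simp only [hR]
    rw [← h]
    congr 4
    funext j
    have := hπ (π.symm j)
    rw [Equiv.apply_symm_apply] at this
    simp only [Function.comp_apply, ← this]
  have hsum : ∑ j ∈ Finset.range (N + 2), ((N + 1).choose j : ℝ) * τ j = 1 := by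
    have h := re_trace_tensorOp_mul hτ (fun _ => 1) (fun _ => 1)
    simp only [Complex.ofReal_one, one_smul, add_sub_cancel, tensorOp_one, one_mul,
      hρ.trace_eq_one, Complex.one_re, Finset.prod_const, Finset.card_univ, Fintype.card_fin,
      map_one] at h
    rw [h, add_pow, map_sum]
    refine Finset.sum_congr rfl fun j _ => ?_
    have : (X : ℝ[X]) ^ j * 1 ^ (N + 1 - j) * ((N + 1).choose j : ℝ[X])
        = C ((N + 1).choose j : ℝ) * X ^ j := by
      simp only [map_natCast, one_pow]; ring
    rw [this, coeffFunctional_C_mul_X_pow]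
  exact ⟨fun j => ((N + 1).choose j : ℝ) * τ j,
    fun j => mul_nonneg (by positivity) (hnn _), hsum,
    acceptProb_eq_sum lam hk hτ fun j _ => rfl⟩

/-- The state mixes, over all `S`, the products with `complState Ψ` on `S` and `Ψ` elsewhere, with
weight `τ S.card`. Different patterns are orthogonal, and weights depending only on cardinality give
invariance. -/
lemma exists_state [Nontrivial ι] {Ψ : EuclideanSpace ℂ ι} (hΨ : ‖Ψ‖ = 1) {n : ℕ}
    {τ : ℕ → ℝ} (hτ0 : ∀ j, 0 ≤ τ j)
    (hτ1 : ∑ j ∈ Finset.range (n + 1), (n.choose j : ℝ) * τ j = 1) :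
    ∃ ρ : Matrix (Fin n → ι) (Fin n → ι) ℂ, IsPermInvState ρ ∧ ∀ S : Finset (Fin n),
      ((tensorOp fun j => if j ∈ S then 1 - pureProj Ψ else pureProj Ψ) * ρ).trace.re
        = τ S.card := by
  set T : Finset (Fin n) → Matrix (Fin n → ι) (Fin n → ι) ℂ :=
    fun S => tensorOp fun j => if j ∈ S then complState Ψ else pureProj Ψ with hT
  set ρ := ∑ S : Finset (Fin n), (τ S.card) • T S with hρ
  have hTpos : ∀ S, (T S).PosSemidef := fun S => by
    refine posSemidef_tensorOp fun j => ?_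
    split_ifs
    · exact exists_conjTranspose_mul_compl hΨ (inv_nonneg.2 card_sub_one_pos.le)
    · simpa using exists_conjTranspose_mul_pureProj hΨ zero_le_one
  have hTtr : ∀ S, (T S).trace = 1 := fun S => by
    rw [hT]
    simp only [trace_tensorOp]
    refine Finset.prod_eq_one fun j _ => ?_
    split_ifs
    · exact trace_complState hΨ
    · exact trace_pureProj hΨ
  have hortho : ∀ S S' : Finset (Fin n),
      ((tensorOp fun j => if j ∈ S then 1 - pureProj Ψ else pureProj Ψ) * T S').trace
        = if S = S' then 1 else 0 := fun S S' => by
    simp only [hT, tensorOp_mul, trace_tensorOp]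
    split_ifs with h
    · subst h
      refine Finset.prod_eq_one fun j _ => ?_
      split_ifs
      · rw [complState, Matrix.mul_smul, compl_mul_self hΨ]; exact trace_complState hΨ
      · rw [pureProj_mul_self hΨ, trace_pureProj hΨ]
    · obtain ⟨j, hj⟩ : ∃ j, ¬(j ∈ S ↔ j ∈ S') := by
        by_contra! hcon; exact h (Finset.ext hcon)
      refine Finset.prod_eq_zero (Finset.mem_univ j) ?_
      by_cases h1 : j ∈ S <;> by_cases h2 : j ∈ S'
      · exact absurd (iff_of_true h1 h2) hj
      · simp only [h1, h2, if_true, if_false, compl_mul_pureProj hΨ, Matrix.trace_zero]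
      · simp only [h1, h2, if_true, if_false, complState, Matrix.mul_smul, pureProj_mul_compl hΨ,
          smul_zero, Matrix.trace_zero]
      · exact absurd (iff_of_false h1 h2) hj
  have htr : ρ.trace = 1 := by
    rw [hρ, Matrix.trace_sum]
    simp_rw [Matrix.trace_smul, hTtr, Complex.real_smul, mul_one]
    rw [← Finset.powerset_univ,
      Finset.sum_powerset_apply_card (fun m => ((τ m : ℝ) : ℂ))]
    simp only [Finset.card_univ, Fintype.card_fin]
    rw [← Complex.ofReal_one, ← hτ1, Complex.ofReal_sum]
    exact Finset.sum_congr rfl fun j _ => by simp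
  refine ⟨ρ, ⟨?_, htr, ?_⟩, fun S => ?_⟩
  · exact Matrix.posSemidef_sum _ fun S _ => (hTpos S).smul (hτ0 _)
  · intro π x y
    rw [hρ]
    simp only [Matrix.sum_apply, Matrix.smul_apply]
    refine Fintype.sum_equiv (Equiv.finsetCongr π) _ _ fun S => ?_
    simp only [hT, tensorOp_comp_perm, Equiv.finsetCongr_apply, Finset.card_map]
    congr 2
    funext j
    simp [Finset.mem_map_equiv]
  · rw [hρ, Finset.mul_sum, Matrix.trace_sum]
    simp_rw [Matrix.mul_smul, Matrix.trace_smul, hortho]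
    simp

lemma exists_state_of_distribution [Nontrivial ι] {Ψ : EuclideanSpace ℂ ι} (hΨ : ‖Ψ‖ = 1)
    (lam : ℝ) {N k : ℕ} (hk : k ≤ N) {c : ℕ → ℝ} (hc0 : ∀ j, 0 ≤ c j)
    (hc1 : ∑ j ∈ Finset.range (N + 2), c j = 1) :
    ∃ ρ : Matrix (Fin (N + 1) → ι) (Fin (N + 1) → ι) ℂ, IsPermInvState ρ ∧
      acceptTargetProb Ψ lam k N ρ = ∑ j ∈ Finset.range (N + 2), c j * goodWeight lam k N j ∧
      acceptProb Ψ lam k N ρ = ∑ j ∈ Finset.range (N + 2),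
        c j * (badWeight lam k N j + goodWeight lam k N j) := by
  have hcτ : ∀ j ∈ Finset.range (N + 2),
      c j = ((N + 1).choose j : ℝ) * (c j / (N + 1).choose j) := fun j hj => by
    have := Nat.choose_pos (by have := Finset.mem_range.1 hj; omega : j ≤ N + 1)
    field_simp
  obtain ⟨ρ, hρ, hτ⟩ := exists_state hΨ (n := N + 1) (τ := fun j => c j / (N + 1).choose j)
    (fun j => div_nonneg (hc0 j) (by positivity)) (by rw [← Finset.sum_congr rfl hcτ, hc1])
  exact ⟨ρ, hρ, acceptProb_eq_sum lam hk hτ hcτ⟩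

/-- Independent systems, each of which is orthogonal to the target with probability `q`. -/
lemma exists_iid_state [Nontrivial ι] {Ψ : EuclideanSpace ℂ ι} (hΨ : ‖Ψ‖ = 1) (lam : ℝ) {N k : ℕ}
    (hk : k ≤ N) {q : ℝ} (hq0 : 0 ≤ q) (hq1 : q ≤ 1) :
    ∃ ρ : Matrix (Fin (N + 1) → ι) (Fin (N + 1) → ι) ℂ, IsPermInvState ρ ∧
      acceptTargetProb Ψ lam k N ρ = (1 - q) * failCDF (1 - (1 - lam) * q) N k ∧
      acceptProb Ψ lam k N ρ = failCDF (1 - (1 - lam) * q) N k := by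
  have hq1' : 0 ≤ 1 - q := by linarith
  have hsum : ∀ n : ℕ, ∑ j ∈ Finset.range (n + 1), (n.choose j : ℝ) * (q ^ j * (1 - q) ^ (n - j)) = 1 :=
    fun n => by
      have := add_pow q (1 - q) n
      rw [add_sub_cancel, one_pow] at this
      exact Eq.trans (Finset.sum_congr rfl fun j _ => by ring) this.symm
  obtain ⟨ρ, hρ, hτ⟩ := exists_state hΨ (n := N + 1)
    (τ := fun j => q ^ j * (1 - q) ^ (N + 1 - j)) (fun j => by positivity) (hsum (N + 1))
  -- Binomial thinning: a system is orthogonal with probability `q` and then fails with probability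
  -- `ν`, so each test fails independently with probability `νq`.
  have hthin : ∑ m ∈ Finset.range (N + 1), (N.choose m : ℝ) * failCDF lam m k
      * (q ^ m * (1 - q) ^ (N - m)) = failCDF (1 - (1 - lam) * q) N k := by
    simp_rw [failCDF, Finset.mul_sum, Finset.sum_mul]
    rw [Finset.sum_comm]
    refine Finset.sum_congr rfl fun i hi => ?_
    have hi' : i ≤ N := by have := Finset.mem_range.1 hi; omega
    rw [← sum_choose_mul_failPMF lam hi' fun m => q ^ m * (1 - q) ^ (N - m), failPMF, mul_assoc]
    congr 1
    have := add_pow (lam * q) (1 - q) (N - i)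
    rw [show 1 - (1 - (1 - lam) * q) = (1 - lam) * q by ring,
      show 1 - (1 - lam) * q = lam * q + (1 - q) by ring, this, Finset.mul_sum]
    refine Finset.sum_congr rfl fun l _ => ?_
    rw [show N - (l + i) = N - i - l by omega, mul_pow (1 - lam)]
    ring
  refine ⟨ρ, hρ, ?_, ?_⟩
  · have h := sum_choose_mul_re_trace_testOp lam hk
      (τ := fun j => q ^ j * (1 - q) ^ (N + 1 - j)) hτ 1 0
    simp only [Complex.ofReal_one, Complex.ofReal_zero, one_smul, zero_smul, add_zero, one_mul,
      zero_mul] at h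
    rw [acceptTargetProb, h, ← hthin, Finset.mul_sum]
    refine Finset.sum_congr rfl fun m hm => ?_
    rw [show N + 1 - m = N - m + 1 by have := Finset.mem_range.1 hm; omega]
    ring
  · have h := sum_choose_mul_re_trace_testOp lam hk
      (τ := fun j => q ^ j * (1 - q) ^ (N + 1 - j)) hτ 1 1
    simp only [Complex.ofReal_one, one_smul, add_sub_cancel, one_mul] at h
    rw [acceptProb, h, ← hthin]
    refine Finset.sum_congr rfl fun m hm => ?_
    rw [show N + 1 - m = N - m + 1 by have := Finset.mem_range.1 hm; omega,
      show N + 1 - (m + 1) = N - m by omega]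
    ring

end reduction

/-! ### Attainment of the minimum and bounds on sufficient numbers of tests. -/

section minimum

variable {ι : Type*} [Fintype ι] [DecidableEq ι] [Nontrivial ι] {Ψ : EuclideanSpace ℂ ι}

lemma fidelitySet_eq_image (hΨ : ‖Ψ‖ = 1) (lam : ℝ) {N k : ℕ} (hk : k ≤ N) (δ : ℝ) :
    fidelitySet Ψ lam k N δ =
      (fun c : Fin (N + 2) → ℝ => (∑ j, c j * goodWeight lam k N j)
          / ∑ j, c j * (badWeight lam k N j + goodWeight lam k N j)) ''
        (stdSimplex ℝ (Fin (N + 2)) ∩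
          {c | δ ≤ ∑ j, c j * (badWeight lam k N j + goodWeight lam k N j)}) := by
  ext F
  constructor
  · rintro ⟨ρ, hρ, hδ, rfl⟩
    obtain ⟨c, hc0, hc1, hf, hp⟩ := exists_distribution hΨ lam hk hρ
    rw [Finset.sum_range] at hc1 hf hp
    refine ⟨fun j => c j, ⟨⟨fun j => hc0 j, hc1⟩, ?_⟩, ?_⟩
    · simpa only [Set.mem_ofPred_eq, ← hp] using hδ
    · simp only [condFidelity, hf, hp]
  · rintro ⟨c, ⟨⟨hc0, hc1⟩, hδ⟩, rfl⟩
    -- The value `0` outside the simplex indices never enters the sums, but keeps the weights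
    -- nonnegative.
    set c' : ℕ → ℝ := fun j => if h : j < N + 2 then c ⟨j, h⟩ else 0 with hc'
    have e : ∀ j : Fin (N + 2), c' j = c j := fun j => by simp [hc']
    obtain ⟨ρ, hρ, hf, hp⟩ := exists_state_of_distribution hΨ lam hk (c := c')
      (fun j => by simp only [hc']; split_ifs; exacts [hc0 _, le_rfl])
      (by rw [Finset.sum_range]; simp_rw [e]; exact hc1)
    rw [Finset.sum_range] at hf hp
    simp_rw [e] at hf hp
    refine ⟨ρ, hρ, ?_, ?_⟩
    · rw [hp]; exact hδ
    · rw [condFidelity, hf, hp]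

/-- The minimal conditional fidelity is attained. -/
lemma isLeast_fidelitySet (hΨ : ‖Ψ‖ = 1) (lam : ℝ) {N k : ℕ} (hk : k ≤ N) {δ : ℝ}
    (hδ0 : 0 < δ) (hδ1 : δ ≤ 1) :
    IsLeast (fidelitySet Ψ lam k N δ) (1 - guaranteedInfidelity Ψ lam k N δ) := by
  rw [guaranteedInfidelity, sub_sub_cancel, fidelitySet_eq_image hΨ lam hk]
  refine IsCompact.isLeast_sInf (IsCompact.image_of_continuousOn ?_ ?_) (Set.Nonempty.image _ ?_)
  · refine (isCompact_stdSimplex ℝ (Fin (N + 2))).inter_right (isClosed_le continuous_const ?_)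
    fun_prop
  · refine ContinuousOn.div (by fun_prop) (by fun_prop) fun c hc => ?_
    have : δ ≤ _ := hc.2
    linarith
  · refine ⟨Pi.single 0 1, single_mem_stdSimplex ℝ 0, ?_⟩
    have h : ∑ j : Fin (N + 2), (Pi.single 0 1 : Fin (N + 2) → ℝ) j
        * (badWeight lam k N j + goodWeight lam k N j) = 1 := by
      rw [Finset.sum_eq_single 0]
      · simp only [Pi.single_eq_same, badWeight, goodWeight, Fin.val_zero, failCDF_zero]
        have : (N : ℝ) + 1 ≠ 0 := by positivity
        field_simp
        simp
      · intro j _ hj; simp [hj]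
      · simp
    rw [Set.mem_ofPred_eq, h]
    exact hδ1

lemma le_mul_of_mem_sufficientTests (hΨ : ‖Ψ‖ = 1) {lam ε δ : ℝ} {k N : ℕ} (hδ0 : 0 < δ)
    (hδ1 : δ ≤ 1) (hN : N ∈ sufficientTests Ψ k ε δ lam)
    {ρ : Matrix (Fin (N + 1) → ι) (Fin (N + 1) → ι) ℂ} (hρ : IsPermInvState ρ)
    (hp : δ ≤ acceptProb Ψ lam k N ρ) :
    (1 - ε) * acceptProb Ψ lam k N ρ ≤ acceptTargetProb Ψ lam k N ρ := by
  have hk : k ≤ N := (Nat.le_succ k).trans hN.1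
  have h := (isLeast_fidelitySet hΨ lam hk hδ0 hδ1).2 ⟨ρ, hρ, hp, rfl⟩
  have h2 := hN.2
  rw [condFidelity, le_div_iff₀ (hδ0.trans_le hp)] at h
  refine le_trans (mul_le_mul_of_nonneg_right ?_ (hδ0.le.trans hp)) h
  linarith

/-- Weak duality: averaging the inequalities over the distribution of a minimizer gives `(1 - ε) p -
f ≤ μ (δ - p) ≤ 0`. -/
lemma mem_sufficientTests_of_multiplier (hΨ : ‖Ψ‖ = 1) {lam ε δ μ : ℝ} {k N : ℕ} (hδ0 : 0 < δ)
    (hδ1 : δ ≤ 1) (hk : k + 1 ≤ N) (hμ0 : 0 ≤ μ)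
    (hμ : ∀ j : ℕ, j ≤ N + 1 →
      badWeight lam k N j - ε * (badWeight lam k N j + goodWeight lam k N j)
        ≤ μ * (δ - (badWeight lam k N j + goodWeight lam k N j))) :
    N ∈ sufficientTests Ψ k ε δ lam := by
  refine ⟨hk, ?_⟩
  have hk' : k ≤ N := (Nat.le_succ k).trans hk
  obtain ⟨ρ, hρ, hp, hF⟩ := (isLeast_fidelitySet hΨ lam hk' hδ0 hδ1).1
  obtain ⟨c, hc0, hc1, hf', hp'⟩ := exists_distribution hΨ lam hk' hρ
  suffices h : 1 - ε ≤ condFidelity Ψ lam k N ρ by linarith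
  rw [condFidelity, le_div_iff₀ (hδ0.trans_le hp)]
  have hsum : ∑ j ∈ Finset.range (N + 2),
        c j * (badWeight lam k N j - ε * (badWeight lam k N j + goodWeight lam k N j))
      ≤ ∑ j ∈ Finset.range (N + 2),
        c j * (μ * (δ - (badWeight lam k N j + goodWeight lam k N j))) :=
    Finset.sum_le_sum fun j hj => mul_le_mul_of_nonneg_left
      (hμ j (by have := Finset.mem_range.1 hj; omega)) (hc0 j)
  have e1 : ∑ j ∈ Finset.range (N + 2),
        c j * (badWeight lam k N j - ε * (badWeight lam k N j + goodWeight lam k N j))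
      = (1 - ε) * acceptProb Ψ lam k N ρ - acceptTargetProb Ψ lam k N ρ := by
    rw [hf', hp', Finset.mul_sum, ← Finset.sum_sub_distrib]
    exact Finset.sum_congr rfl fun j _ => by ring
  have e2 : ∑ j ∈ Finset.range (N + 2),
        c j * (μ * (δ - (badWeight lam k N j + goodWeight lam k N j)))
      = μ * (δ * 1 - acceptProb Ψ lam k N ρ) := by
    rw [hp', ← hc1, Finset.mul_sum, ← Finset.sum_sub_distrib, Finset.mul_sum]
    exact Finset.sum_congr rfl fun j _ => by ring
  rw [e1, e2] at hsum
  have : μ * (δ * 1 - acceptProb Ψ lam k N ρ) ≤ 0 :=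
    mul_nonpos_of_nonneg_of_nonpos hμ0 (by linarith)
  linarith

/-- Independent systems give a lower bound on the number of tests. -/
lemma div_le_of_mem_sufficientTests (hΨ : ‖Ψ‖ = 1) {lam ε δ : ℝ} {k N : ℕ} (h1 : lam < 1)
    (hε0 : 0 < ε) (hε1 : ε < 1) (hδ0 : 0 < δ) (hδ1 : δ ≤ 1 / 2)
    (hN : N ∈ sufficientTests Ψ k ε δ lam) : (k : ℝ) / ((1 - lam) * ε) ≤ N := by
  have hν : 0 < 1 - lam := by linarith
  have hkN : k < N := hN.1
  have hN0 : (0 : ℝ) < N := by exact_mod_cast (Nat.zero_le k).trans_lt hkN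
  by_contra! hcon
  rw [lt_div_iff₀ (by positivity)] at hcon
  -- The largest probability for which the mean number `νqN` of failures does not exceed `k`; if the
  -- asserted bound fails, then `q > ε`.
  set q : ℝ := min 1 (k / ((1 - lam) * N)) with hq
  have hq0 : 0 ≤ q := le_min zero_le_one (by positivity)
  have hqε : ε < q := by
    refine lt_min hε1 ?_
    rw [lt_div_iff₀ (by positivity)]
    linarith
  have hqk : (1 - lam) * q * N ≤ k := by
    have : q ≤ k / ((1 - lam) * N) := min_le_right _ _
    rw [le_div_iff₀ (by positivity)] at this
    linarith
  obtain ⟨ρ, hρ, hf, hp⟩ := exists_iid_state hΨ lam hkN.le hq0 (min_le_left _ _)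
  have hhalf := half_le_failCDF hkN (by positivity) hqk
  have h := le_mul_of_mem_sufficientTests hΨ hδ0 (by linarith) hN hρ (by rw [hp]; linarith)
  rw [hf, hp] at h
  have := le_of_mul_le_mul_right h (by linarith)
  linarith

/-- States with a fixed number of systems orthogonal to the target give a lower bound on the number
of tests. -/
lemma log_bound_of_mem_sufficientTests (hΨ : ‖Ψ‖ = 1) {lam ε δ : ℝ} {k N : ℕ} (h0 : 0 < lam)
    (h1 : lam < 1) (hε0 : 0 < ε) (hε1 : ε < 1) (hδ0 : 0 < δ) (hδ1 : δ ≤ 1)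
    (hN : N ∈ sufficientTests Ψ k ε δ lam) :
    (1 - (1 - lam) * ε) * Real.log δ⁻¹ / (lam * ε * Real.log lam⁻¹)
      - (1 - ε) * (k + 1) / (lam * ε) - 2 ≤ N := by
  have hk : k ≤ N := (Nat.le_succ k).trans hN.1
  have hloglam : 0 < Real.log lam⁻¹ := Real.log_pos ((one_lt_inv₀ h0).2 h1)
  have hL0 : 0 ≤ Real.log δ⁻¹ := Real.log_nonneg ((one_le_inv₀ hδ0).2 hδ1)
  set r := Real.log δ⁻¹ / Real.log lam⁻¹ with hr
  have hr0 : 0 ≤ r := by positivity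
  -- `j` orthogonal systems are accepted with probability at least `δ`
  have key : ∀ j : ℕ, (j : ℝ) ≤ r → j ≤ N + 1 →
      (1 - ε) * (badWeight lam k N j + goodWeight lam k N j) ≤ goodWeight lam k N j := by
    intro j hj hjN
    obtain ⟨ρ, hρ, hf, hp⟩ := exists_state_of_distribution hΨ lam hk (c := Pi.single j 1)
      (fun i => by by_cases h : i = j <;> simp [h])
      (by simpa [Finset.sum_pi_single] using (by omega : j < N + 2))
    have hs : ∀ w : ℕ → ℝ, ∑ i ∈ Finset.range (N + 2), (Pi.single j 1 : ℕ → ℝ) i * w i = w j := by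
      intro w
      rw [Finset.sum_eq_single j]
      · simp
      · intro i _ hi; simp [hi]
      · intro h; exact absurd (Finset.mem_range.2 (by omega)) h
    rw [hs] at hf hp
    have hδj : δ ≤ acceptProb Ψ lam k N ρ := by
      rw [hp]
      refine le_trans ?_ (failCDF_le_badWeight_add_goodWeight h0 h1.le k N j)
      refine le_trans ?_ (pow_le_failCDF h0.le h1.le j k)
      rw [hr, le_div_iff₀ hloglam, Real.log_inv, Real.log_inv] at hj
      rw [← Real.log_le_log_iff hδ0 (by positivity), Real.log_pow]
      linarith
    have h := le_mul_of_mem_sufficientTests hΨ hδ0 hδ1 hN hρ hδj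
    rwa [hf, hp] at h
  have hN1 : (0 : ℝ) < N + 1 := by positivity
  -- Otherwise all `N + 1` systems could be orthogonal to the target and still be accepted with
  -- probability at least `δ`, with fidelity zero.
  have hjN : ⌊r⌋₊ ≤ N := by
    by_contra! hcon
    have h := key (N + 1) ((Nat.cast_le.2 hcon).trans (Nat.floor_le hr0)) le_rfl
    have hb : 0 < badWeight lam k N (N + 1) := by
      have := failCDF_pos h0 h1.le N k
      unfold badWeight; rw [Nat.add_sub_cancel]; positivity
    have hg : goodWeight lam k N (N + 1) = 0 := by simp [goodWeight]
    rw [hg, add_zero] at h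
    have : 0 < (1 - ε) * badWeight lam k N (N + 1) := mul_pos (by linarith) hb
    linarith
  have main : (1 - (1 - lam) * ε) * (⌊r⌋₊ : ℝ) - (1 - ε) * k ≤ lam * ε * (N + 1) := by
    rcases Nat.eq_zero_or_pos ⌊r⌋₊ with hj | hj
    · rw [hj]
      have : 0 ≤ (1 - ε) * (k : ℝ) := mul_nonneg (by linarith) (by positivity)
      have : 0 ≤ lam * ε * ((N : ℝ) + 1) := by positivity
      push_cast
      linarith
    · obtain ⟨m, hm⟩ : ∃ m, ⌊r⌋₊ = m + 1 := ⟨⌊r⌋₊ - 1, by omega⟩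
      have h := key ⌊r⌋₊ (Nat.floor_le hr0) (by omega)
      rw [hm] at h ⊢
      unfold badWeight goodWeight at h
      rw [Nat.add_sub_cancel, ← add_div, ← mul_div_assoc, div_le_div_iff_of_pos_right hN1] at h
      have hF := failCDF_pos h0 h1.le (m + 1) k
      have h2 := mul_le_mul_of_nonneg_left (sub_mul_failCDF_succ_le h0.le h1.le m k)
        (by linarith : 0 ≤ 1 - ε)
      push_cast at h ⊢
      have h3 : (1 - ε) * (m + 1 - k) * failCDF lam (m + 1) k
          ≤ lam * ε * (N + 1 - (m + 1)) * failCDF lam (m + 1) k := by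
        have := mul_le_mul_of_nonneg_left h h0.le
        linarith
      have := le_of_mul_le_mul_right h3 hF
      linarith
  -- Rounding `r` costs `1 - νε = (1 - ε) + λε`: the first part turns `k` into `k + 1`, while `λε`
  -- and the shift from `N` to `N + 1` make up the final `2`.
  have hlt := (Nat.lt_floor_add_one r).le
  have hνε : 0 ≤ 1 - (1 - lam) * ε := by nlinarith
  have h2 := mul_le_mul_of_nonneg_left hlt hνε
  have e : (1 - (1 - lam) * ε) * Real.log δ⁻¹ / (lam * ε * Real.log lam⁻¹)
      - (1 - ε) * (k + 1) / (lam * ε) - 2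
      = ((1 - (1 - lam) * ε) * r - (1 - ε) * (k + 1) - 2 * (lam * ε)) / (lam * ε) := by
    rw [hr]; field_simp
  rw [e, div_le_iff₀ (by positivity)]
  linarith

/-- A sufficient number of tests, for a given variance proxy `C` of the Bernoulli distribution. -/
lemma exists_mem_sufficientTests_lt (hΨ : ‖Ψ‖ = 1) {lam ε δ C : ℝ} (k : ℕ) (h0 : 0 < lam)
    (h1 : lam < 1) (hε0 : 0 < ε) (hε1 : ε < 1) (hδ0 : 0 < δ) (hδ1 : δ < 1) (hC0 : 0 < C)
    (hC : ∀ z : ℝ, 0 < z → z ≤ 1 → lam * (1 - lam) * z ≤ C * (lam + (1 - lam) * z) ^ 2) :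
    ∃ N ∈ sufficientTests Ψ k ε δ lam, (N : ℝ) < k / ((1 - lam) * ε)
      + (2 * C * Real.log δ⁻¹ + Real.sqrt (2 * C * (1 - lam) * k * Real.log δ⁻¹))
          / ((1 - lam) ^ 2 * lam * ε)
      + Real.sqrt (lam * k) / (lam * ε) + 2 / (lam * ε) := by
  have hν : 0 < 1 - lam := by linarith
  have hL : 0 < Real.log δ⁻¹ := Real.log_pos ((one_lt_inv₀ hδ0).2 hδ1)
  set L := Real.log δ⁻¹ with hLdef
  set s := Real.sqrt (2 * C * (1 - lam) * k * L) with hs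
  have hs0 : 0 ≤ s := Real.sqrt_nonneg _
  have hs2 : s ^ 2 = 2 * C * (1 - lam) * k * L := Real.sq_sqrt (by positivity)
  -- An upper estimate, by subadditivity of the square root, of the positive root of `ν²t² = 2CL(k/ν
  -- + t)`.
  set t := (2 * C * L + s) / (1 - lam) ^ 2 with ht
  have ht0 : 0 < t := by positivity
  set σ := Real.sqrt (lam * k) with hσ
  have hσ0 : 0 ≤ σ := Real.sqrt_nonneg _
  set X := (k : ℝ) / ((1 - lam) * ε) + (2 * C * L + s) / ((1 - lam) ^ 2 * lam * ε)
    + σ / (lam * ε) + 2 / (lam * ε) with hX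
  have hXε : ε * lam * X = lam * (k / (1 - lam)) + t + σ + 2 := by
    rw [hX, ht]; field_simp
  have hkX : (k : ℝ) + 2 ≤ X := by
    have hle : lam * ε ≤ 1 := by nlinarith
    have q1 : (k : ℝ) ≤ k / ((1 - lam) * ε) :=
      le_div_self (by positivity) (by positivity) (by nlinarith)
    have q2 : (2 : ℝ) ≤ 2 / (lam * ε) :=
      le_div_self (by positivity) (by positivity) (by linarith)
    have q3 : 0 ≤ (2 * C * L + s) / ((1 - lam) ^ 2 * lam * ε) := by positivity
    have q4 : 0 ≤ σ / (lam * ε) := by positivity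
    linarith
  have hceil : k + 2 ≤ ⌈X⌉₊ := by
    have : ((k + 2 : ℕ) : ℝ) ≤ ⌈X⌉₊ := by push_cast; exact hkX.trans (Nat.le_ceil X)
    exact_mod_cast this
  -- This is why the inequality is strict: `N < X ≤ N + 1`, and the multiplier only needs `N + 1` to
  -- be large.
  obtain ⟨N, hN⟩ : ∃ N, ⌈X⌉₊ = N + 1 := ⟨⌈X⌉₊ - 1, by omega⟩
  have hNX : X ≤ N + 1 := by have := Nat.le_ceil X; rw [hN] at this; exact_mod_cast this
  refine ⟨N, ?_, Nat.lt_ceil.1 (by omega)⟩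
  obtain ⟨μ, hμ0, hμ⟩ := exists_multiplier (k := k) (N := N) (t := t) h0 h1 hε0 hε1 hδ0 hC0 ht0 hC
    (by
      have e1 : (1 - lam) ^ 2 * t ^ 2 = (2 * C * L + s) ^ 2 / (1 - lam) ^ 2 := by
        rw [ht]; field_simp
      have e2 : 2 * C * L * (k / (1 - lam) + t)
          = (s ^ 2 + 2 * C * L * (2 * C * L + s)) / (1 - lam) ^ 2 := by
        rw [ht, hs2]; field_simp
      rw [← hLdef, e1, e2]
      gcongr
      have : 0 ≤ 2 * C * L * s := by positivity
      nlinarith)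
    (by
      have : ε * lam * X ≤ ε * lam * (N + 1) := by gcongr
      linarith)
  exact mem_sufficientTests_of_multiplier hΨ hδ0 hδ1.le (by omega) hμ0 hμ

end minimum

theorem propositionS6 {ι : Type*} [Fintype ι] [DecidableEq ι] [Nontrivial ι]
    (Ψ : EuclideanSpace ℂ ι) (hΨ : ‖Ψ‖ = 1)
    (lam ν ε δ : ℝ) (k : ℕ)
    (hlam0 : 0 < lam) (hlam1 : lam < 1) (hν : ν = 1 - lam)
    (hε0 : 0 < ε) (hε1 : ε < 1) (hδ0 : 0 < δ) (hδ1 : δ ≤ 1 / 2) :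
    -- the two minima in the definition of `N_k` are attained
    (∀ N : ℕ, k + 1 ≤ N →
      IsLeast (fidelitySet Ψ lam k N δ) (1 - guaranteedInfidelity Ψ lam k N δ)) ∧
    IsLeast (sufficientTests Ψ k ε δ lam) (minTests Ψ k ε δ lam) ∧
    -- the bounds
    (k : ℝ) / (ν * ε) ≤ (minTests Ψ k ε δ lam : ℝ) ∧
    (minTests Ψ k ε δ lam : ℝ) <
      k / (ν * ε) + Real.log δ⁻¹ / (2 * ν ^ 2 * lam * ε)
        + Real.sqrt (2 * ν * k * Real.log δ⁻¹) / (2 * ν ^ 2 * lam * ε)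
        + Real.sqrt (lam * k) / (lam * ε) + 2 / (lam * ε) ∧
    (minTests Ψ k ε δ lam : ℝ) ≥
      (1 - ν * ε) * Real.log δ⁻¹ / (lam * ε * Real.log lam⁻¹)
        - (1 - ε) * (k + 1) / (lam * ε) - 2 ∧
    (1 / 2 ≤ lam →
      (minTests Ψ k ε δ lam : ℝ) <
        k / (ν * ε) + 2 * Real.log δ⁻¹ / (ν * ε)
          + Real.sqrt (2 * lam * k * Real.log δ⁻¹) / (lam * ν * ε)
          + Real.sqrt (lam * k) / (lam * ε) + 2 / (lam * ε)) := by
  subst hν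
  have hν0 : 0 < 1 - lam := by linarith
  have hδ1' : δ < 1 := by linarith
  have hle : ∀ N ∈ sufficientTests Ψ k ε δ lam, (minTests Ψ k ε δ lam : ℝ) ≤ N :=
    fun N hN => Nat.cast_le.2 (Nat.sInf_le hN)
  -- `C = 1/4` is the universal bound `λνz ≤ (λ + νz)²/4`.
  obtain ⟨N₁, hN₁, hlt₁⟩ := exists_mem_sufficientTests_lt hΨ (C := 1 / 4) k hlam0 hlam1 hε0 hε1
    hδ0 hδ1' (by norm_num) fun z _ _ => by nlinarith [sq_nonneg (lam - (1 - lam) * z)]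
  have hmem : minTests Ψ k ε δ lam ∈ sufficientTests Ψ k ε δ lam := Nat.sInf_mem ⟨N₁, hN₁⟩
  refine ⟨fun N hN => isLeast_fidelitySet hΨ lam ((Nat.le_succ k).trans hN) hδ0 hδ1'.le,
    ⟨hmem, fun N hN => Nat.sInf_le hN⟩,
    div_le_of_mem_sufficientTests hΨ hlam1 hε0 hε1 hδ0 hδ1 hmem,
    ((hle _ hN₁).trans_lt hlt₁).trans_eq ?_,
    log_bound_of_mem_sufficientTests hΨ hlam0 hlam1 hε0 hε1 hδ0 hδ1'.le hmem, fun hlam2 => ?_⟩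
  · have e : Real.sqrt (2 * (1 / 4) * (1 - lam) * k * Real.log δ⁻¹)
        = Real.sqrt (2 * (1 - lam) * k * Real.log δ⁻¹) / 2 := by
      rw [show 2 * (1 / 4) * (1 - lam) * k * Real.log δ⁻¹
          = 2 * (1 - lam) * k * Real.log δ⁻¹ / 2 ^ 2 by ring, Real.sqrt_div' _ (by positivity),
        Real.sqrt_sq (by positivity)]
    rw [e]
    field_simp
    ring
  -- For `λ ≥ 1/2` and `z ≤ 1` one has `z ≤ (λ + νz)²`, so the true variance `λν` is admissible.
  · obtain ⟨N₂, hN₂, hlt₂⟩ := exists_mem_sufficientTests_lt hΨ (C := lam * (1 - lam)) k hlam0 hlam1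
      hε0 hε1 hδ0 hδ1' (by positivity) fun z hz0 hz1 => by
        refine mul_le_mul_of_nonneg_left ?_ (by positivity)
        have e : (lam + (1 - lam) * z) ^ 2 - z = (1 - z) * (lam ^ 2 - (1 - lam) ^ 2 * z) := by ring
        have : 0 ≤ lam ^ 2 - (1 - lam) ^ 2 * z := by nlinarith
        have := mul_nonneg (sub_nonneg.2 hz1) this
        linarith
    refine ((hle _ hN₂).trans_lt hlt₂).trans_eq ?_
    have e : Real.sqrt (2 * (lam * (1 - lam)) * (1 - lam) * k * Real.log δ⁻¹)
        = Real.sqrt (2 * lam * k * Real.log δ⁻¹) * (1 - lam) := by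
      rw [show 2 * (lam * (1 - lam)) * (1 - lam) * k * Real.log δ⁻¹
          = 2 * lam * k * Real.log δ⁻¹ * (1 - lam) ^ 2 by ring,
        Real.sqrt_mul' _ (by positivity), Real.sqrt_sq hν0.le]
    rw [e]
    field_simp
    ring
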